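/- Let $k\ge 1$. A $k$-graph $\Lambda$ is a countable small category with a functor $d:\Lambda\to\mathbb N^k$ such that whenever $d(\lambda)=n+m$ there are unique $\mu,\nu\in\Lambda$ with $d(\mu)=n$, $d(\nu)=m$ and $\lambda=\mu\nu$. Write $r,s$ for range and source (so $\mu\nu$ is defined when $s(\mu)=r(\nu)$), $\Lambda^n=d^{-1}(n)$, identify $\Lambda^0$ with the set of objects (vertices), and call the elements of $\Lambda^1:=\bigcup_{i=1}^k\Lambda^{e_i}$ edges. Put $\Lambda^{\min}(\mu,\nu)=\{(\alpha,\beta):\mu\alpha=\nu\beta,\ d(\mu\alpha)=d(\mu)\vee d(\nu)\}$. $\Lambda$ is finitely aligned if all these sets are finite. A set $E\subseteq v\Lambda:=r^{-1}(v)$ is exhaustive for $v\in\Lambda^0$ if for every $\mu\in v\Lambda$ there is $\nu\in E$ with $\Lambda^{\min}(\mu,\nu)\ne\emptyset$. For finitely aligned $\Lambda$, a Cuntz–Krieger $\Lambda$-family in a C*-algebra is a family of partial isometries $(S_\mu)_{\mu\in\Lambda}$ such that: the $S_v$ ($v\in\Lambda^0$) are mutually orthogonal projections; $S_{\mu\nu}=S_\mu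 S_\nu$ if $s(\mu)=r(\nu)$; $S_\mu^*S_\nu=\sum_{(\alpha,\beta)\in\Lambda^{\min}(\mu,\nu)}S_\alpha S_\beta^*$ for all $\mu,\nu$; and $\prod_{\mu\in E}(S_v-S_\mu S_\mu^*)=0$ for every vertex $v$ and every finite exhaustive $E\subseteq v\Lambda$. $C^*(\Lambda)$ is the C*-algebra generated by a universal Cuntz–Krieger $\Lambda$-family $(s_\mu)_{\mu\in\Lambda}$. Let $(X,\eta)$ be a $\sigma$-finite measure space. A $\Lambda$-branching system on $(X,\eta)$ consists of measurable sets $D_v$ ($v\in\Lambda^0$), $R_\mu$ ($\mu\in\Lambda^1$) and measurable maps $f_\mu:D_{s(\mu)}\to R_\mu$, $f_\mu^{-1}:R_\mu\to D_{s(\mu)}$ ($\mu\in\Lambda^1$), where $f_\mu^{-1}$ is an inverse of $f_\mu$ up to null sets (that is, $f_\mu\circ f_\mu^{-1}=\mathrm{id}$ a.e. on $R_\mu$ and $f_\mu^{-1}\circ f_\mu=\mathrm{id}$ a.e. on $D_{s(\mu)}$), such that 1. $\eta(R_\mu\cap R_\nu)=0$ for distinct edges $\mu,\nu$ of the same degree;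 2. $\eta(D_v\cap D_w)=0$ for distinct vertices $v,w$; 3. $R_\mu\subseteq D_{r(\mu)}$ up to a null set; 4. the pushforward $\eta\circ f_\mu$ of $\eta|_{R_\mu}$ under $f_\mu^{-1}$ is absolutely continuous with respect to $\eta$ on $D_{s(\mu)}$, and the pushforward $\eta\circ f_\mu^{-1}$ of $\eta|_{D_{s(\mu)}}$ under $f_\mu$ is absolutely continuous with respect to $\eta$ on $R_\mu$; 5. $f_\mu\circ f_\nu=f_\alpha\circ f_\beta$ a.e. on $D_{s(\nu)}$ whenever $\mu,\nu,\alpha,\beta$ are edges with $\mu\nu=\alpha\beta$; 6. for edges $\mu,\nu$ with $r(\mu)=r(\nu)$ and $d(\mu)\ne d(\nu)$, the set $f_\mu\bigl(D_{s(\mu)}\setminus\bigcup_{(\alpha,\beta)\in\Lambda^{\min}(\mu,\nu)}R_\alpha\bigr)\cap f_\nu\bigl(D_{s(\nu)}\setminus\bigcup_{(\alpha,\beta)\in\Lambda^{\min}(\mu,\nu)}R_\beta\bigr)$ is contained in a null set; 7. $\bigcup_{\mu\in E}R_\mu=D_v$ up to a null set, for every $v\in\Lambda^0$ and every finite set $E\subseteq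 v\Lambda\cap\Lambda^1$ that is exhaustive for $v$. For an edge $\mu$ let $\Phi_{f_\mu^{-1}}=d(\eta\circ f_\mu^{-1})/d\eta$ be the Radon–Nikodym derivative on $R_\mu$. **Theorem.** Let $\Lambda$ be a finitely aligned $k$-graph and let $\{D_v,R_\mu,f_\mu\}$ be a $\Lambda$-branching system on a $\sigma$-finite measure space $(X,\eta)$. Then there exists a unique representation ($*$-homomorphism) $\pi:C^*(\Lambda)\to B(L^2(X,\eta))$ such that, for all edges $\mu$, all vertices $v$ and all $\phi\in L^2(X,\eta)$, $$\pi(s_\mu)\phi=\Phi_{f_\mu^{-1}}^{1/2}\,(\phi\circ f_\mu^{-1})\quad\text{and}\quad \pi(s_v)\phi=\chi_{D_v}\phi ,$$ where the first right-hand side is understood to be $0$ outside $R_\mu$. -/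

import Mathlib

open CategoryTheory MeasureTheory
open scoped ENNReal

universe w u v

/-- The composite `lam = μν` of paths: the source of `μ` is the range of `ν`, and `lam` is the
path that follows `μ` after `ν`. A path is an arrow of the category; its source is `left`, its
range is `right`. -/
def IsComp {V : Type u} [Category.{v} V] (μ ν lam : Arrow V) : Prop :=
  ∃ h : ν.right = μ.left, lam = Arrow.mk (ν.hom ≫ eqToHom h ≫ μ.hom)

/-- A `k`-graph: a small category (paths are its arrows, vertices its objects) with a functor `deg`
to the monoid `ℕ^k` having the factorization property. -/
structure KGraph (k : ℕ) (V : Type u) [Category.{v} V] where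
  deg : Arrow V → (Fin k → ℕ)
  deg_id : ∀ a : V, deg (Arrow.mk (𝟙 a)) = 0
  deg_comp : ∀ {a b c : V} (g : a ⟶ b) (h : b ⟶ c),
    deg (Arrow.mk (g ≫ h)) = deg (Arrow.mk h) + deg (Arrow.mk g)
  factorization : ∀ (lam : Arrow V) (n m : Fin k → ℕ), deg lam = n + m →
    ∃! p : Arrow V × Arrow V, deg p.1 = n ∧ deg p.2 = m ∧ IsComp p.1 p.2 lam

/-- The vertex `a`, regarded as a path of degree `0`. -/
def vertexPath {V : Type u} [Category.{v} V] (a : V) : Arrow V := Arrow.mk (𝟙 a)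

namespace KGraph

variable {k : ℕ} {V : Type u} [Category.{v} V]

/-- `Λ^min(μ, ν)`: the pairs `(α, β)` with `μα = νβ` and `d(μα) = d(μ) ∨ d(ν)`. -/
def minExt (Λ : KGraph k V) (μ ν : Arrow V) : Set (Arrow V × Arrow V) :=
  {p | ∃ lam, IsComp μ p.1 lam ∧ IsComp ν p.2 lam ∧ Λ.deg lam = Λ.deg μ ⊔ Λ.deg ν}

/-- `Λ` is finitely aligned. -/
def FinitelyAligned (Λ : KGraph k V) : Prop :=
  ∀ μ ν : Arrow V, (Λ.minExt μ ν).Finite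

/-- `E` is a subset of `aΛ` that is exhaustive for the vertex `a`. -/
def Exhaustive (Λ : KGraph k V) (a : V) (E : Set (Arrow V)) : Prop :=
  (∀ ν ∈ E, ν.right = a) ∧
    ∀ μ : Arrow V, μ.right = a → ∃ ν ∈ E, (Λ.minExt μ ν).Nonempty

/-- Edges: the paths whose degree is one of the standard basis vectors `e_i`. -/
def Edge (Λ : KGraph k V) : Type (max u v) :=
  {μ : Arrow V // ∃ i : Fin k, Λ.deg μ = Pi.single i 1}

/-- The underlying path of an edge. -/
def Edge.path {Λ : KGraph k V} (μ : Λ.Edge) : Arrow V := μ.1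

/-- The source of an edge. -/
def Edge.src {Λ : KGraph k V} (μ : Λ.Edge) : V := μ.1.left

/-- The range of an edge. -/
def Edge.rng {Λ : KGraph k V} (μ : Λ.Edge) : V := μ.1.right

/-- Cuntz-Krieger `Λ`-families in a C*-algebra `B`, for finitely aligned `Λ` (so that the sum is a
finite one). The product over a finite exhaustive set, written out as a duplicate-free list, is
taken in the corner of `B` whose unit is the projection `S_a`; the factors commute by the other
relations, so that the order of the list does not matter. -/
structure IsCKFamily (Λ : KGraph k V) {B : Type w} [NonUnitalCStarAlgebra B]
    (S : Arrow V → B) : Prop where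
  partialIsometry : ∀ μ, S μ * star (S μ) * S μ = S μ
  vertex_selfAdjoint : ∀ a : V, star (S (vertexPath a)) = S (vertexPath a)
  vertex_idempotent : ∀ a : V, S (vertexPath a) * S (vertexPath a) = S (vertexPath a)
  vertex_orthogonal : ∀ a b : V, a ≠ b → S (vertexPath a) * S (vertexPath b) = 0
  comp : ∀ μ ν lam, IsComp μ ν lam → S lam = S μ * S ν
  star_mul_eq : ∀ μ ν, star (S μ) * S ν = ∑ᶠ p ∈ Λ.minExt μ ν, S p.1 * star (S p.2)
  exhaustive : ∀ (a : V) (l : List (Arrow V)), l.Nodup → Λ.Exhaustive a {μ | μ ∈ l} →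
    l.foldr (fun μ b => (S (vertexPath a) - S μ * star (S μ)) * b) (S (vertexPath a)) = 0

/-- All Cuntz-Krieger `Λ`-families in C*-algebras (of universe `w`). -/
structure CKRep (Λ : KGraph k V) : Type (max (w + 1) u v) where
  B : Type w
  [inst : NonUnitalCStarAlgebra B]
  S : Arrow V → B
  isCK : Λ.IsCKFamily S

attribute [instance] CKRep.inst

theorem norm_le_one_of_partialIsometry {B : Type w} [NonUnitalCStarAlgebra B] (t : B)
    (ht : t * star t * t = t) : ‖t‖ ≤ 1 := by
  have h1 : (star t * t) * (star t * t) = star t * t := by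
    calc (star t * t) * (star t * t) = star t * (t * star t * t) := by simp only [mul_assoc]
      _ = star t * t := by rw [ht]
  have h2 : ‖star t * t‖ = ‖t‖ * ‖t‖ := CStarRing.norm_star_mul_self
  have h3 : ‖star (star t * t) * (star t * t)‖ = ‖star t * t‖ * ‖star t * t‖ :=
    CStarRing.norm_star_mul_self
  rw [star_mul, star_star, h1, h2] at h3
  by_contra hc
  push Not at hc
  have h4 : 1 < ‖t‖ * ‖t‖ := by nlinarith
  nlinarith

/-- The `ℓ^∞`-product of the C*-algebras of all Cuntz-Krieger `Λ`-families. -/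
abbrev BigProduct (Λ : KGraph k V) : Type (max (w + 1) u v) :=
  lp (fun i : CKRep.{w} Λ => i.B) ∞

/-- The universal Cuntz-Krieger `Λ`-family: its coordinate at each family is that family. -/
noncomputable def universalFamily (Λ : KGraph k V) (μ : Arrow V) : BigProduct.{w} Λ :=
  ⟨fun i => i.S μ, memℓp_infty ⟨1, by
    rintro _ ⟨i, rfl⟩
    exact norm_le_one_of_partialIsometry _ (i.isCK.partialIsometry μ)⟩⟩

/-- The C*-subalgebra generated by the universal Cuntz-Krieger `Λ`-family. -/
noncomputable def cstarSubalgebra (Λ : KGraph k V) : NonUnitalStarSubalgebra ℂ (BigProduct.{w} Λ) :=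
  (NonUnitalStarAlgebra.adjoin ℂ (Set.range (universalFamily.{w} Λ))).topologicalClosure

/-- The `k`-graph C*-algebra `C*(Λ)`. -/
abbrev CStar (Λ : KGraph k V) : Type (max (w + 1) u v) := cstarSubalgebra.{w} Λ

instance cstarSubalgebra_isClosed (Λ : KGraph k V) :
    IsClosed (cstarSubalgebra.{w} Λ : Set (BigProduct.{w} Λ)) :=
  NonUnitalStarSubalgebra.isClosed_topologicalClosure _

noncomputable instance (Λ : KGraph k V) : NonUnitalCStarAlgebra (CStar.{w} Λ) :=
  NonUnitalStarSubalgebra.nonUnitalCStarAlgebra (cstarSubalgebra.{w} Λ)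

/-- The generator `s_μ` of `C*(Λ)`. -/
noncomputable def gen (Λ : KGraph k V) (μ : Arrow V) : CStar.{w} Λ :=
  ⟨universalFamily.{w} Λ μ, NonUnitalStarSubalgebra.le_topologicalClosure _
    (NonUnitalStarAlgebra.subset_adjoin ℂ _ ⟨μ, rfl⟩)⟩

/-- A `Λ`-branching system on `(X, η)`. The maps `f_μ : D_{s(μ)} → R_μ` and
`f_μ⁻¹ : R_μ → D_{s(μ)}` are given by functions on `X`, of which only the values on `D_{s(μ)}` and
on `R_μ`, respectively, matter. -/
structure BranchingSystem (Λ : KGraph k V) {X : Type w} [MeasurableSpace X]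
    (η : Measure X) where
  D : V → Set X
  R : Λ.Edge → Set X
  f : Λ.Edge → X → X
  fInv : Λ.Edge → X → X
  measurableSet_D : ∀ a, MeasurableSet (D a)
  measurableSet_R : ∀ μ, MeasurableSet (R μ)
  R_disjoint : ∀ μ ν : Λ.Edge, μ ≠ ν → Λ.deg μ.path = Λ.deg ν.path → η (R μ ∩ R ν) = 0
  D_disjoint : ∀ a b : V, a ≠ b → η (D a ∩ D b) = 0
  R_subset : ∀ μ : Λ.Edge, R μ ≤ᵐ[η] D μ.rng
  mapsTo_f : ∀ μ : Λ.Edge, Set.MapsTo (f μ) (D μ.src) (R μ)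
  mapsTo_fInv : ∀ μ : Λ.Edge, Set.MapsTo (fInv μ) (R μ) (D μ.src)
  measurable_f : ∀ μ : Λ.Edge, Measurable ((D μ.src).domRestrict (f μ))
  measurable_fInv : ∀ μ : Λ.Edge, Measurable ((R μ).domRestrict (fInv μ))
  f_fInv : ∀ μ : Λ.Edge, ∀ᵐ x ∂(η.restrict (R μ)), f μ (fInv μ x) = x
  fInv_f : ∀ μ : Λ.Edge, ∀ᵐ x ∂(η.restrict (D μ.src)), fInv μ (f μ x) = x
  absolutelyContinuous_f : ∀ μ : Λ.Edge,
    (η.restrict (R μ)).map (fInv μ) ≪ η.restrict (D μ.src)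
  absolutelyContinuous_fInv : ∀ μ : Λ.Edge,
    (η.restrict (D μ.src)).map (f μ) ≪ η.restrict (R μ)
  comp_eq : ∀ (μ ν α β : Λ.Edge) (lam : Arrow V),
    IsComp μ.path ν.path lam → IsComp α.path β.path lam →
      ∀ᵐ x ∂(η.restrict (D ν.src)), f μ (f ν x) = f α (f β x)
  min_disjoint : ∀ μ ν : Λ.Edge, μ.rng = ν.rng → Λ.deg μ.path ≠ Λ.deg ν.path →
    η (f μ '' (D μ.src \ ⋃ (α : Λ.Edge) (_ : ∃ β : Arrow V,
            (α.path, β) ∈ Λ.minExt μ.path ν.path), R α) ∩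
        f ν '' (D ν.src \ ⋃ (β : Λ.Edge) (_ : ∃ α : Arrow V,
            (α, β.path) ∈ Λ.minExt μ.path ν.path), R β)) = 0
  exhaustive : ∀ (a : V) (E : Finset Λ.Edge), Λ.Exhaustive a (Edge.path '' (E : Set Λ.Edge)) →
    (⋃ μ ∈ E, R μ) =ᵐ[η] D a

/-- The Radon-Nikodym derivative `Φ_{f_μ⁻¹} = d(η ∘ f_μ⁻¹)/dη` on `R_μ`, where `η ∘ f_μ⁻¹` is the
pushforward under `f_μ` of the restriction of `η` to `D_{s(μ)}`. -/
noncomputable def BranchingSystem.Phi {Λ : KGraph k V} {X : Type w} [MeasurableSpace X]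
    {η : Measure X} (S : Λ.BranchingSystem η) (μ : Λ.Edge) : X → ℝ≥0∞ :=
  ((η.restrict (S.D μ.src)).map (S.f μ)).rnDeriv (η.restrict (S.R μ))

end KGraph

/-! By change of variables, `|S_μ φ|² dη` is the image under `f_μ` of `|φ|² dη` on `D_{s(μ)}`. So
the edge operator `S_μ` is a partial isometry from `L²(D_{s(μ)})` onto `L²(R_μ)`: `S_μ* S_μ` is
multiplication by `χ_{D_{s(μ)}}` and `S_μ S_μ*` multiplication by `χ_{R_μ}` (`star_op_mul_op`,
`op_mul_star_op`). The axioms of a branching system then become relations between these operators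
for edges and vertices (`edgeRelations_pathOp`).

The algebraic core is that relations for edges and vertices already force all Cuntz-Krieger
relations (`EdgeRelations.isCKFamily`). Products along paths are well defined because different
factorizations into edges are linked by commuting squares (`extendAux_succ`). The formula for `S_μ*
S_ν` is proved for two edges by compressing to complementary projections (`star_edge_mul_edge`), and
spreads to paths by induction on length, since minimal common extensions with a composite path are
computed in two stages (`sum_minExt_comp`). A finite exhaustive set is reduced to the exhaustive set
of its first edges, and induction on a bound for the degrees handles what follows each edge
(`vertex_mul_eq_zero`).

The universal property of `C*(Λ)` gives existence. Uniqueness holds because every path is a vertex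
or a product of edges. -/

/-! ### Composition of paths -/

section IsComp

variable {V : Type u} [Category.{v} V]

theorem isComp_mk {a b c : V} (g : a ⟶ b) (h : b ⟶ c) :
    IsComp (Arrow.mk h) (Arrow.mk g) (Arrow.mk (g ≫ h)) :=
  ⟨rfl, by simp⟩

theorem IsComp.exists_mk {μ ν lam : Arrow V} (H : IsComp μ ν lam) :
    ∃ (a b c : V) (g : a ⟶ b) (h : b ⟶ c),
      μ = Arrow.mk h ∧ ν = Arrow.mk g ∧ lam = Arrow.mk (g ≫ h) := by
  obtain ⟨c, d, m⟩ := μ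
  obtain ⟨a, b, n⟩ := ν
  obtain ⟨h, rfl⟩ := H
  change b = c at h
  subst h
  exact ⟨a, b, d, n, m, rfl, rfl, by simp⟩

theorem IsComp.source_eq {μ ν lam : Arrow V} (H : IsComp μ ν lam) : ν.right = μ.left := H.1

theorem IsComp.left_eq {μ ν lam : Arrow V} (H : IsComp μ ν lam) : lam.left = ν.left := by
  obtain ⟨_, rfl⟩ := H; rfl

theorem IsComp.right_eq {μ ν lam : Arrow V} (H : IsComp μ ν lam) : lam.right = μ.right := by
  obtain ⟨_, rfl⟩ := H; rfl

theorem IsComp.unique {μ ν lam lam' : Arrow V} (H : IsComp μ ν lam) (H' : IsComp μ ν lam') :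
    lam = lam' := by
  obtain ⟨_, rfl⟩ := H; obtain ⟨_, rfl⟩ := H'; rfl

theorem exists_isComp {μ ν : Arrow V} (h : ν.right = μ.left) : ∃ lam, IsComp μ ν lam :=
  ⟨_, h, rfl⟩

theorem isComp_vertex_left (μ : Arrow V) : IsComp (vertexPath μ.right) μ μ := by
  have := isComp_mk μ.hom (𝟙 μ.right)
  rw [Category.comp_id] at this
  exact this

theorem isComp_vertex_right (μ : Arrow V) : IsComp μ (vertexPath μ.left) μ := by
  have := isComp_mk (𝟙 μ.left) μ.hom
  rw [Category.id_comp] at this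
  exact this

theorem IsComp.assoc {μ ν ρ σ lam : Arrow V} (H : IsComp μ ν σ) (H' : IsComp σ ρ lam) :
    ∃ τ, IsComp ν ρ τ ∧ IsComp μ τ lam := by
  obtain ⟨c, d, m⟩ := μ
  obtain ⟨a, b, n⟩ := ν
  obtain ⟨e, f, q⟩ := ρ
  obtain ⟨h, rfl⟩ := H
  obtain ⟨h', rfl⟩ := H'
  change b = c at h
  change f = a at h'
  subst h
  subst h'
  refine ⟨_, isComp_mk q n, ?_⟩
  have := isComp_mk (q ≫ n) m
  rw [Category.assoc] at this
  simp
  exact this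

theorem IsComp.assoc_symm {μ ν ρ τ lam : Arrow V} (H : IsComp ν ρ τ) (H' : IsComp μ τ lam) :
    ∃ σ, IsComp μ ν σ ∧ IsComp σ ρ lam := by
  obtain ⟨σ, hσ⟩ := exists_isComp (μ := μ) (ν := ν) (by rw [← H.right_eq, H'.source_eq])
  obtain ⟨lam', hl⟩ := exists_isComp (μ := σ) (ν := ρ) (by rw [hσ.left_eq, H.source_eq])
  obtain ⟨τ', h1, h2⟩ := hσ.assoc hl
  obtain rfl := H.unique h1
  obtain rfl := H'.unique h2
  exact ⟨σ, hσ, hl⟩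

open Classical in
/-- Composition of paths, extended by an arbitrary value to pairs that are not composable. -/
noncomputable def compPath (μ ν : Arrow V) : Arrow V :=
  if h : ν.right = μ.left then Arrow.mk (ν.hom ≫ eqToHom h ≫ μ.hom) else μ

theorem isComp_compPath {μ ν : Arrow V} (h : ν.right = μ.left) : IsComp μ ν (compPath μ ν) :=
  ⟨h, by rw [compPath, dif_pos h]⟩

end IsComp

/-! ### Factorizations and minimal common extensions -/

namespace KGraph

variable {k : ℕ} {V : Type u} [Category.{v} V] (Λ : KGraph k V)

theorem deg_eq_of_isComp {μ ν lam : Arrow V} (H : IsComp μ ν lam) :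
    Λ.deg lam = Λ.deg μ + Λ.deg ν := by
  obtain ⟨a, b, c, g, h, rfl, rfl, rfl⟩ := H.exists_mk
  exact Λ.deg_comp g h

theorem deg_vertexPath (a : V) : Λ.deg (vertexPath a) = 0 := Λ.deg_id a

theorem isComp_cancel {μ ν μ' ν' lam : Arrow V} (H : IsComp μ ν lam) (H' : IsComp μ' ν' lam)
    (h : Λ.deg μ = Λ.deg μ') : μ = μ' ∧ ν = ν' := by
  have h1 := Λ.deg_eq_of_isComp H
  have h2 := Λ.deg_eq_of_isComp H'
  have h3 : Λ.deg ν = Λ.deg ν' := by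
    rw [h1, h] at h2
    exact add_left_cancel h2
  have := (Λ.factorization lam _ _ h1).unique (y₁ := (μ, ν)) (y₂ := (μ', ν')) ⟨rfl, rfl, H⟩
    ⟨h.symm, h3.symm, H'⟩
  exact Prod.ext_iff.1 this

theorem isComp_left_cancel (Λ : KGraph k V) {μ ν ν' lam : Arrow V} (H : IsComp μ ν lam) (H' : IsComp μ ν' lam) :
    ν = ν' := (Λ.isComp_cancel H H' rfl).2

theorem eq_vertexPath {μ : Arrow V} (h : Λ.deg μ = 0) : μ = vertexPath μ.left := by
  refine (Λ.isComp_cancel (isComp_vertex_left μ) (isComp_vertex_right μ) ?_).2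
  rw [h, deg_vertexPath]

theorem eq_vertexPath_right {μ : Arrow V} (h : Λ.deg μ = 0) : μ = vertexPath μ.right := by
  refine (Λ.isComp_cancel (isComp_vertex_left μ) (isComp_vertex_right μ) ?_).1.symm
  rw [h, deg_vertexPath]

theorem exists_split {lam : Arrow V} {n : Fin k → ℕ} (h : n ≤ Λ.deg lam) :
    ∃ μ ν, Λ.deg μ = n ∧ IsComp μ ν lam := by
  obtain ⟨⟨μ, ν⟩, ⟨h1, -, h2⟩, -⟩ := Λ.factorization lam n (Λ.deg lam - n)
    (add_tsub_cancel_of_le h).symm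
  exact ⟨μ, ν, h1, h2⟩

theorem exists_split_isComp {μ ν lam : Arrow V} {n : Fin k → ℕ} (H : IsComp μ ν lam)
    (h : Λ.deg μ ≤ n) {σ δ : Arrow V} (hσ : Λ.deg σ = n) (H' : IsComp σ δ lam) :
    ∃ α, IsComp μ α σ ∧ IsComp α δ ν := by
  obtain ⟨μ', α, h1, h2⟩ := Λ.exists_split (lam := σ) (n := Λ.deg μ) (hσ ▸ h)
  obtain ⟨τ, h3, h4⟩ := h2.assoc H'
  obtain ⟨rfl, rfl⟩ := Λ.isComp_cancel h4 H h1
  exact ⟨α, h2, h3⟩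

/-- Cut the common extension at degree `d(μ) ∨ d(ν)`. By uniqueness of factorizations the initial
segment extends both `μ` and `ν`, and the rest is the common tail `δ`. -/
theorem exists_minExt {μ ν α β lam : Arrow V} (H : IsComp μ α lam) (H' : IsComp ν β lam) :
    ∃ p ∈ Λ.minExt μ ν, ∃ δ, IsComp p.1 δ α ∧ IsComp p.2 δ β := by
  have h1 := Λ.deg_eq_of_isComp H
  have h2 := Λ.deg_eq_of_isComp H'
  obtain ⟨σ, δ, h3, h4⟩ := Λ.exists_split (lam := lam) (n := Λ.deg μ ⊔ Λ.deg ν)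
    (sup_le (h1 ▸ le_self_add) (h2 ▸ le_self_add))
  obtain ⟨α', ha, ha'⟩ := Λ.exists_split_isComp H le_sup_left h3 h4
  obtain ⟨β', hb, hb'⟩ := Λ.exists_split_isComp H' le_sup_right h3 h4
  exact ⟨(α', β'), ⟨σ, ha, hb, h3⟩, δ, ha', hb'⟩

theorem minExt_swap {μ ν : Arrow V} {p : Arrow V × Arrow V} (h : p ∈ Λ.minExt μ ν) :
    p.swap ∈ Λ.minExt ν μ := by
  obtain ⟨lam, h1, h2, h3⟩ := h
  exact ⟨lam, h2, h1, by rw [h3, sup_comm]⟩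

variable {Λ}

theorem minExt_right_eq {μ ν : Arrow V} {p : Arrow V × Arrow V} (h : p ∈ Λ.minExt μ ν) :
    μ.right = ν.right := by
  obtain ⟨lam, h1, h2, -⟩ := h
  rw [← h1.right_eq, h2.right_eq]

theorem minExt_left_eq {μ ν : Arrow V} {p : Arrow V × Arrow V} (h : p ∈ Λ.minExt μ ν) :
    p.1.left = p.2.left := by
  obtain ⟨lam, h1, h2, -⟩ := h
  rw [← h1.left_eq, h2.left_eq]

/-- Coordinatewise, `(m ⊔ n) - m` is the truncated difference `n - m`. -/
theorem minExt_deg_fst {μ ν : Arrow V} {p : Arrow V × Arrow V} (h : p ∈ Λ.minExt μ ν) :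
    Λ.deg p.1 = Λ.deg ν - Λ.deg μ := by
  obtain ⟨lam, h1, -, h3⟩ := h
  rw [Λ.deg_eq_of_isComp h1] at h3
  funext i
  have := congrFun h3 i
  simp only [Pi.add_apply, Pi.sup_apply, Pi.sub_apply] at this ⊢
  omega

theorem minExt_deg_snd {μ ν : Arrow V} {p : Arrow V × Arrow V} (h : p ∈ Λ.minExt μ ν) :
    Λ.deg p.2 = Λ.deg μ - Λ.deg ν := minExt_deg_fst (Λ.minExt_swap h)

theorem minExt_fst_right {μ ν : Arrow V} {p : Arrow V × Arrow V} (h : p ∈ Λ.minExt μ ν) :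
    p.1.right = μ.left := by
  obtain ⟨lam, h1, -, -⟩ := h
  exact h1.source_eq

theorem minExt_snd_right {μ ν : Arrow V} {p : Arrow V × Arrow V} (h : p ∈ Λ.minExt μ ν) :
    p.2.right = ν.left := minExt_fst_right (Λ.minExt_swap h)

theorem minExt_snd_eq {μ ν : Arrow V} {p q : Arrow V × Arrow V} (hp : p ∈ Λ.minExt μ ν)
    (hq : q ∈ Λ.minExt μ ν) (h : p.1 = q.1) : p.2 = q.2 := by
  obtain ⟨lam, h1, h2, -⟩ := hp
  obtain ⟨lam', h1', h2', -⟩ := hq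
  rw [h] at h1
  obtain rfl := h1.unique h1'
  exact Λ.isComp_left_cancel h2 h2'

theorem minExt_fst_eq {μ ν : Arrow V} {p q : Arrow V × Arrow V} (hp : p ∈ Λ.minExt μ ν)
    (hq : q ∈ Λ.minExt μ ν) (h : p.2 = q.2) : p.1 = q.1 :=
  minExt_snd_eq (Λ.minExt_swap hp) (Λ.minExt_swap hq) h

theorem minExt_of_deg_eq {μ ν : Arrow V} (h : Λ.deg μ = Λ.deg ν) {p : Arrow V × Arrow V}
    (hp : p ∈ Λ.minExt μ ν) : μ = ν ∧ p = (vertexPath μ.left, vertexPath μ.left) := by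
  have h1 := minExt_deg_fst hp
  have h2 := minExt_deg_snd hp
  have h3 := minExt_fst_right hp
  have h4 := minExt_snd_right hp
  have h5 := hp
  obtain ⟨lam, ha, hb, -⟩ := hp
  have : μ = ν := (Λ.isComp_cancel ha hb h).1
  subst this
  simp only [tsub_self] at h1 h2
  refine ⟨rfl, Prod.ext ?_ ?_⟩
  · rw [Λ.eq_vertexPath_right h1, h3]
  · rw [Λ.eq_vertexPath_right h2, h4]

theorem minExt_self (μ : Arrow V) :
    Λ.minExt μ μ = {(vertexPath μ.left, vertexPath μ.left)} := by
  ext p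
  refine ⟨fun h => (minExt_of_deg_eq rfl h).2, ?_⟩
  rintro rfl
  exact ⟨μ, isComp_vertex_right μ, isComp_vertex_right μ, by simp⟩

theorem minExt_vertexPath {a : V} {ν : Arrow V} (h : ν.right = a) :
    Λ.minExt (vertexPath a) ν = {(ν, vertexPath ν.left)} := by
  subst h
  have key : (ν, vertexPath ν.left) ∈ Λ.minExt (vertexPath ν.right) ν :=
    ⟨ν, isComp_vertex_left ν, isComp_vertex_right ν, by simp [deg_vertexPath]⟩
  ext p
  constructor
  · intro hp
    have h2 := minExt_deg_snd hp
    simp only [deg_vertexPath, zero_tsub] at h2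
    have h3 : p.2 = vertexPath ν.left := by
      rw [Λ.eq_vertexPath_right h2, minExt_snd_right hp]
    exact Prod.ext (minExt_fst_eq hp key h3) h3
  · rintro rfl
    exact key

/-- The pasted diagram is again minimal because `m₁ + (m₂ ⊔ (n - m₁)) = (m₁ + m₂) ⊔ n`. The
intermediate path `σ` is recorded because `p` is recovered from it. -/
theorem minExt_comp_mem {μ₁ μ₂ μ ν : Arrow V} (H : IsComp μ₁ μ₂ μ) {p r : Arrow V × Arrow V}
    (hp : p ∈ Λ.minExt μ₁ ν) (hr : r ∈ Λ.minExt μ₂ p.1) :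
    IsComp p.2 r.2 (compPath p.2 r.2) ∧ ∃ lam σ, IsComp μ r.1 lam ∧
      IsComp ν (compPath p.2 r.2) lam ∧ Λ.deg lam = Λ.deg μ ⊔ Λ.deg ν ∧
      IsComp μ₁ p.1 σ ∧ IsComp ν p.2 σ ∧ IsComp σ r.2 lam ∧
      Λ.deg σ = Λ.deg μ₁ ⊔ Λ.deg ν := by
  have e1 := minExt_left_eq hp
  have e2 := minExt_snd_right hr
  have e3 := minExt_deg_fst hp
  obtain ⟨σ, h1, h2, h3⟩ := hp
  obtain ⟨τ, g1, g2, g3⟩ := hr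
  have hc := isComp_compPath (μ := p.2) (ν := r.2) (by rw [e2, e1])
  obtain ⟨lam, hl⟩ := exists_isComp (μ := μ₁) (ν := τ) (by rw [g1.right_eq, H.source_eq])
  obtain ⟨μ', a1, a2⟩ := g1.assoc_symm hl
  obtain rfl := H.unique a1
  obtain ⟨σ', b1, b2⟩ := g2.assoc_symm hl
  obtain rfl := h1.unique b1
  obtain ⟨τ', c1, c2⟩ := h2.assoc b2
  obtain rfl := hc.unique c1
  refine ⟨hc, lam, σ, a2, c2, ?_, h1, h2, b2, h3⟩
  rw [Λ.deg_eq_of_isComp hl, g3, e3, Λ.deg_eq_of_isComp H]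
  funext i
  simp only [Pi.add_apply, Pi.sup_apply, Pi.sub_apply]
  omega

/-- A minimal common extension of `μ₁μ₂` and `ν` arises from exactly one `p` in `Λ^min(μ₁, ν)`
followed by one `r` in `Λ^min(μ₂, p.1)`. This drives every induction on length for `S_μ* S_ν`. -/
theorem sum_minExt_comp (hΛ : Λ.FinitelyAligned) {M : Type*} [AddCommMonoid M]
    {μ₁ μ₂ μ : Arrow V} (H : IsComp μ₁ μ₂ μ) (ν : Arrow V) (F : Arrow V → Arrow V → M) :
    ∑ q ∈ (hΛ μ ν).toFinset, F q.1 q.2 =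
      ∑ p ∈ (hΛ μ₁ ν).toFinset, ∑ r ∈ (hΛ μ₂ p.1).toFinset, F r.1 (compPath p.2 r.2) := by
  rw [Finset.sum_sigma']
  symm
  refine Finset.sum_bij (fun x _ => (x.2.1, compPath x.1.2 x.2.2)) ?_ ?_ ?_ ?_
  · rintro ⟨p, r⟩ h
    simp only [Finset.mem_sigma, Set.Finite.mem_toFinset] at h ⊢
    obtain ⟨-, lam, σ, h1, h2, h3, -⟩ := minExt_comp_mem H h.1 h.2
    exact ⟨lam, h1, h2, h3⟩
  · rintro ⟨p, r⟩ h ⟨p', r'⟩ h' heq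
    simp only [Finset.mem_sigma, Set.Finite.mem_toFinset] at h h'
    simp only [Prod.mk.injEq] at heq
    obtain ⟨-, lam, σ, h1, h2, h3, h4, h5, h6, h7⟩ := minExt_comp_mem H h.1 h.2
    obtain ⟨-, lam', σ', h1', h2', h3', h4', h5', h6', h7'⟩ := minExt_comp_mem H h'.1 h'.2
    rw [heq.1] at h1
    obtain rfl := h1.unique h1'
    -- Both `σ` are the initial segment of the same path in degree `d(μ₁) ∨ d(ν)`; so they agree,
    -- and with them `p` and then `r`.
    obtain ⟨rfl, h8⟩ := Λ.isComp_cancel h6 h6' (by rw [h7, h7'])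
    have h9 : p = p' := Prod.ext (Λ.isComp_left_cancel h4 h4') (Λ.isComp_left_cancel h5 h5')
    have h10 : r = r' := Prod.ext heq.1 h8
    rw [h9, h10]
  · rintro ⟨γ, ε⟩ h
    simp only [Set.Finite.mem_toFinset] at h
    obtain ⟨lam, h1, h2, h3⟩ := h
    -- Regarded as an extension of `μ₁` and `ν` only, the path factors through a minimal `p`; the
    -- tail `δ` supplies the second stage.
    obtain ⟨τ, g1, g2⟩ := H.assoc h1
    obtain ⟨p, hp, δ, a1, a2⟩ := Λ.exists_minExt g2 h2
    have hd := minExt_deg_fst hp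
    have hr : (γ, δ) ∈ Λ.minExt μ₂ p.1 := by
      refine ⟨τ, g1, a1, ?_⟩
      have e := Λ.deg_eq_of_isComp g2
      rw [h3, Λ.deg_eq_of_isComp H] at e
      rw [hd]
      funext i
      have := congrFun e i
      simp only [Pi.add_apply, Pi.sup_apply, Pi.sub_apply] at this ⊢
      omega
    refine ⟨⟨p, (γ, δ)⟩, by simp [hp, hr], ?_⟩
    simp only [Prod.mk.injEq, true_and]
    exact (isComp_compPath a2.source_eq).unique a2
  · intros; rfl

end KGraph

/-! ### Length, and products along factorizations into edges -/

namespace KGraph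

variable {k : ℕ} {V : Type u} [Category.{v} V]

/-- The number of edges in a factorization of a path into edges. -/
def length (Λ : KGraph k V) (μ : Arrow V) : ℕ := ∑ i, Λ.deg μ i

theorem length_eq_of_isComp (Λ : KGraph k V) {μ ν lam : Arrow V} (H : IsComp μ ν lam) :
    Λ.length lam = Λ.length μ + Λ.length ν := by
  simp only [length, Λ.deg_eq_of_isComp H, Pi.add_apply, Finset.sum_add_distrib]

theorem length_vertexPath (Λ : KGraph k V) (a : V) : Λ.length (vertexPath a) = 0 := by
  simp [length, deg_vertexPath]

theorem deg_eq_zero_of_length (Λ : KGraph k V) {μ : Arrow V} (h : Λ.length μ = 0) :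
    Λ.deg μ = 0 := by
  funext i
  exact (Finset.sum_eq_zero_iff.1 h) i (Finset.mem_univ i)

theorem length_edge {Λ : KGraph k V} (μ : Λ.Edge) : Λ.length μ.path = 1 := by
  obtain ⟨μ, i, h⟩ := μ
  simp [length, Edge.path, h]

theorem exists_first_edge (Λ : KGraph k V) {lam : Arrow V} (h : Λ.deg lam ≠ 0) :
    ∃ (μ : Λ.Edge) (ν : Arrow V), IsComp μ.path ν lam := by
  obtain ⟨i, hi⟩ := Function.ne_iff.1 h
  obtain ⟨μ, ν, h1, h2⟩ := Λ.exists_split (lam := lam) (n := Pi.single i 1) (by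
    intro j
    by_cases hj : j = i
    · subst hj
      simpa using Nat.one_le_iff_ne_zero.2 hi
    · simp [hj])
  exact ⟨⟨μ, i, h1⟩, ν, h2⟩

/-- Since `e_j - e_i = e_j` for `i ≠ j`, minimal common extensions of edges of different degrees are
commuting squares of edges. -/
theorem edge_deg_sub {Λ : KGraph k V} {μ ν : Λ.Edge} (h : Λ.deg μ.path ≠ Λ.deg ν.path) :
    Λ.deg ν.path - Λ.deg μ.path = Λ.deg ν.path := by
  obtain ⟨μ, i, hi⟩ := μ
  obtain ⟨ν, j, hj⟩ := ν
  simp only [Edge.path, hi, hj] at h ⊢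
  have hij : i ≠ j := by rintro rfl; exact h rfl
  funext l
  simp only [Pi.sub_apply, Pi.single_apply]
  split_ifs with h1 h2 <;> simp_all

theorem exists_edge_fst {Λ : KGraph k V} {μ ν : Λ.Edge} (h : Λ.deg μ.path ≠ Λ.deg ν.path)
    {p : Arrow V × Arrow V} (hp : p ∈ Λ.minExt μ.path ν.path) :
    ∃ α : Λ.Edge, α.path = p.1 ∧ Λ.deg α.path = Λ.deg ν.path := by
  have h1 := minExt_deg_fst hp
  rw [edge_deg_sub h] at h1
  obtain ⟨j, hj⟩ := ν.2
  exact ⟨⟨p.1, j, h1.trans hj⟩, rfl, h1⟩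

theorem exists_edge_snd {Λ : KGraph k V} {μ ν : Λ.Edge} (h : Λ.deg μ.path ≠ Λ.deg ν.path)
    {p : Arrow V × Arrow V} (hp : p ∈ Λ.minExt μ.path ν.path) :
    ∃ β : Λ.Edge, β.path = p.2 ∧ Λ.deg β.path = Λ.deg μ.path :=
  exists_edge_fst h.symm (Λ.minExt_swap hp)

theorem edge_ext {Λ : KGraph k V} {μ ν : Λ.Edge} (h : μ.path = ν.path) : μ = ν := Subtype.ext h

section Extend

variable {Λ : KGraph k V} {B : Type*} [Semigroup B]

open Classical in
/-- The product of the values of `T` along a factorization of a path of length `n` into edges. -/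
noncomputable def extendAux (Λ : KGraph k V) (T : Λ.Edge → B) (P : V → B) : ℕ → Arrow V → B
  | 0, lam => P lam.left
  | n + 1, lam =>
    if h : ∃ p : Λ.Edge × Arrow V, IsComp p.1.path p.2 lam then
      T h.choose.1 * extendAux Λ T P n h.choose.2
    else P lam.left

/-- The extension of a family indexed by edges and vertices to a family indexed by paths. -/
noncomputable def extend (Λ : KGraph k V) (T : Λ.Edge → B) (P : V → B) (lam : Arrow V) : B :=
  extendAux Λ T P (Λ.length lam) lam

variable {T : Λ.Edge → B} {P : V → B}

theorem extendAux_of_exists (n : ℕ) {lam : Arrow V}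
    (h : ∃ p : Λ.Edge × Arrow V, IsComp p.1.path p.2 lam) :
    extendAux Λ T P (n + 1) lam = T h.choose.1 * extendAux Λ T P n h.choose.2 := by
  rw [extendAux, dif_pos h]

/-- The definition uses a chosen first edge; this shows that the choice is immaterial. -/
theorem extendAux_succ
    (hT : ∀ (μ ν α β : Λ.Edge) (lam : Arrow V), IsComp μ.path ν.path lam →
      IsComp α.path β.path lam → T μ * T ν = T α * T β) (n : ℕ) :
    ∀ (lam : Arrow V), Λ.length lam = n + 1 → ∀ (μ : Λ.Edge) (ν : Arrow V),
      IsComp μ.path ν lam → extendAux Λ T P (n + 1) lam = T μ * extendAux Λ T P n ν := by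
  induction n with
  | zero =>
    intro lam hl μ ν H
    have hex : ∃ p : Λ.Edge × Arrow V, IsComp p.1.path p.2 lam := ⟨(μ, ν), H⟩
    rw [extendAux_of_exists _ hex]
    have H0 := hex.choose_spec
    set p := hex.choose
    have h1 := Λ.length_eq_of_isComp H
    have h2 := Λ.length_eq_of_isComp H0
    rw [length_edge] at h1 h2
    have e1 := Λ.eq_vertexPath_right (Λ.deg_eq_zero_of_length (μ := ν) (by omega))
    have e2 := Λ.eq_vertexPath_right (Λ.deg_eq_zero_of_length (μ := p.2) (by omega))
    rw [H.source_eq] at e1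
    rw [H0.source_eq] at e2
    have e3 : μ.path = lam := by
      rw [e1] at H
      exact (isComp_vertex_right μ.path).unique H
    have e4 : p.1.path = lam := by
      rw [e2] at H0
      exact (isComp_vertex_right p.1.path).unique H0
    rw [edge_ext (e4.trans e3.symm), e2, e1, e3, e4]
  | succ m ih =>
    intro lam hl μ ν H
    have hex : ∃ p : Λ.Edge × Arrow V, IsComp p.1.path p.2 lam := ⟨(μ, ν), H⟩
    rw [extendAux_of_exists _ hex]
    have H0 := hex.choose_spec
    set p := hex.choose
    have h1 := Λ.length_eq_of_isComp H
    have h2 := Λ.length_eq_of_isComp H0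
    rw [length_edge] at h1 h2
    by_cases hd : Λ.deg p.1.path = Λ.deg μ.path
    · obtain ⟨e1, e2⟩ := Λ.isComp_cancel H0 H hd
      rw [edge_ext e1, e2]
    · obtain ⟨q, hq, δ, hδ1, hδ2⟩ := Λ.exists_minExt H0 H
      obtain ⟨α, hα, -⟩ := exists_edge_fst hd hq
      obtain ⟨β, hβ, -⟩ := exists_edge_snd hd hq
      rw [← hα] at hδ1
      rw [← hβ] at hδ2
      rw [ih p.2 (by omega) α δ hδ1, ih ν (by omega) β δ hδ2, ← mul_assoc, ← mul_assoc]
      obtain ⟨σ, g1, g2, -⟩ := hq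
      rw [← hα] at g1
      rw [← hβ] at g2
      rw [hT _ _ _ _ _ g1 g2]

theorem extend_vertexPath (a : V) : extend Λ T P (vertexPath a) = P a := by
  rw [extend, length_vertexPath, extendAux]
  rfl

theorem extend_edge_mul
    (hT : ∀ (μ ν α β : Λ.Edge) (lam : Arrow V), IsComp μ.path ν.path lam →
      IsComp α.path β.path lam → T μ * T ν = T α * T β)
    {μ : Λ.Edge} {ν lam : Arrow V} (H : IsComp μ.path ν lam) :
    extend Λ T P lam = T μ * extend Λ T P ν := by
  have h := Λ.length_eq_of_isComp H
  rw [length_edge, add_comm] at h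
  rw [extend, h, extendAux_succ hT _ _ h _ _ H, extend]

theorem extend_edge
    (hT : ∀ (μ ν α β : Λ.Edge) (lam : Arrow V), IsComp μ.path ν.path lam →
      IsComp α.path β.path lam → T μ * T ν = T α * T β)
    (hs : ∀ μ : Λ.Edge, T μ * P μ.src = T μ) (μ : Λ.Edge) :
    extend Λ T P μ.path = T μ := by
  rw [extend_edge_mul hT (isComp_vertex_right μ.path), extend_vertexPath]
  exact hs μ

theorem extend_comp
    (hT : ∀ (μ ν α β : Λ.Edge) (lam : Arrow V), IsComp μ.path ν.path lam →
      IsComp α.path β.path lam → T μ * T ν = T α * T β)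
    (hr : ∀ μ : Λ.Edge, P μ.rng * T μ = T μ) (hP : ∀ a, P a * P a = P a) (n : ℕ) :
    ∀ {μ ν lam : Arrow V}, Λ.length μ = n → IsComp μ ν lam →
      extend Λ T P lam = extend Λ T P μ * extend Λ T P ν := by
  induction n with
  | zero =>
    intro μ ν lam hn H
    have h1 := Λ.eq_vertexPath (Λ.deg_eq_zero_of_length hn)
    rw [← H.source_eq] at h1
    have h2 : lam = ν := by
      rw [h1] at H
      exact H.unique (isComp_vertex_left ν)
    rw [h1, h2, extend_vertexPath]
    by_cases h0 : Λ.deg ν = 0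
    · rw [Λ.eq_vertexPath_right h0, extend_vertexPath]
      exact (hP _).symm
    · obtain ⟨g, ν', hg⟩ := Λ.exists_first_edge h0
      rw [extend_edge_mul hT hg, hg.right_eq, ← mul_assoc]
      exact congrArg (· * _) (hr g).symm
  | succ m ih =>
    intro μ ν lam hn H
    have h0 : Λ.deg μ ≠ 0 := by
      intro h0
      simp [length, h0] at hn
    obtain ⟨g, μ', hg⟩ := Λ.exists_first_edge h0
    obtain ⟨τ, h1, h2⟩ := hg.assoc H
    have h3 := Λ.length_eq_of_isComp hg
    rw [length_edge] at h3
    rw [extend_edge_mul hT h2, extend_edge_mul hT hg, ih (by omega) h1, mul_assoc]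

end Extend

/-- The Cuntz-Krieger relations, required for vertices and edges only. The last two relations are
stated elementwise, without the products and sums of projections. -/
structure EdgeRelations (Λ : KGraph k V) {B : Type w} [NonUnitalCStarAlgebra B]
    (S : Arrow V → B) : Prop where
  vertex_selfAdjoint : ∀ a : V, star (S (vertexPath a)) = S (vertexPath a)
  vertex_idempotent : ∀ a : V, S (vertexPath a) * S (vertexPath a) = S (vertexPath a)
  vertex_orthogonal : ∀ a b : V, a ≠ b → S (vertexPath a) * S (vertexPath b) = 0
  comp : ∀ μ ν lam, IsComp μ ν lam → S lam = S μ * S ν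
  star_mul_self : ∀ μ : Λ.Edge, star (S μ.path) * S μ.path = S (vertexPath μ.src)
  star_mul_of_deg_eq : ∀ μ ν : Λ.Edge, μ ≠ ν → Λ.deg μ.path = Λ.deg ν.path →
    star (S μ.path) * S ν.path = 0
  star_mul_of_deg_ne : ∀ μ ν : Λ.Edge, μ.rng = ν.rng → Λ.deg μ.path ≠ Λ.deg ν.path →
    ∀ x y : B,
      (∀ α : Λ.Edge, (∃ β : Arrow V, (α.path, β) ∈ Λ.minExt μ.path ν.path) →
        star (S α.path) * x = 0) →
      (∀ β : Λ.Edge, (∃ α : Arrow V, (α, β.path) ∈ Λ.minExt μ.path ν.path) →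
        star (S β.path) * y = 0) →
      star (S μ.path * x) * (S ν.path * y) = 0
  exhaustive : ∀ (a : V) (E : Finset Λ.Edge), Λ.Exhaustive a (Edge.path '' (E : Set Λ.Edge)) →
    ∀ x : B, (∀ μ ∈ E, star (S μ.path) * x = 0) → S (vertexPath a) * x = 0

/-! ### From edge relations to Cuntz-Krieger families -/

namespace EdgeRelations

variable {Λ : KGraph k V} {B : Type w} [NonUnitalCStarAlgebra B] {S : Arrow V → B}

theorem vertex_mul (h : Λ.EdgeRelations S) (μ : Arrow V) :
    S (vertexPath μ.right) * S μ = S μ := (h.comp _ _ _ (isComp_vertex_left μ)).symm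

theorem mul_vertex (h : Λ.EdgeRelations S) (μ : Arrow V) :
    S μ * S (vertexPath μ.left) = S μ := (h.comp _ _ _ (isComp_vertex_right μ)).symm

theorem star_mul_vertex (h : Λ.EdgeRelations S) (μ : Arrow V) :
    star (S μ) * S (vertexPath μ.right) = star (S μ) := by
  conv_rhs => rw [← h.vertex_mul μ, star_mul, h.vertex_selfAdjoint]

theorem vertex_mul_star (h : Λ.EdgeRelations S) (μ : Arrow V) :
    S (vertexPath μ.left) * star (S μ) = star (S μ) := by
  conv_rhs => rw [← h.mul_vertex μ, star_mul, h.vertex_selfAdjoint]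

theorem star_mul_of_right_ne (h : Λ.EdgeRelations S) {μ ν : Arrow V} (hne : μ.right ≠ ν.right) :
    star (S μ) * S ν = 0 := by
  rw [← h.star_mul_vertex μ, ← h.vertex_mul ν, mul_assoc, ← mul_assoc (S (vertexPath μ.right)),
    h.vertex_orthogonal _ _ hne, zero_mul, mul_zero]

theorem star_mul_vertexPath (h : Λ.EdgeRelations S) (hΛ : Λ.FinitelyAligned) (a : V)
    (ν : Arrow V) :
    star (S (vertexPath a)) * S ν =
      ∑ p ∈ (hΛ (vertexPath a) ν).toFinset, S p.1 * star (S p.2) := by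
  by_cases ha : ν.right = a
  · have : (hΛ (vertexPath a) ν).toFinset = {(ν, vertexPath ν.left)} := by
      apply Finset.coe_injective
      simpa using minExt_vertexPath ha
    rw [this, Finset.sum_singleton, h.vertex_selfAdjoint, h.vertex_selfAdjoint, h.mul_vertex,
      ← ha, h.vertex_mul]
  · rw [h.star_mul_of_right_ne (Ne.symm ha), Finset.sum_eq_zero]
    intro p hp
    exact absurd (minExt_right_eq ((Set.Finite.mem_toFinset _).1 hp)).symm ha

theorem star_mul_symm (hΛ : Λ.FinitelyAligned) {μ ν : Arrow V}
    (H : star (S μ) * S ν = ∑ p ∈ (hΛ μ ν).toFinset, S p.1 * star (S p.2)) :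
    star (S ν) * S μ = ∑ p ∈ (hΛ ν μ).toFinset, S p.1 * star (S p.2) := by
  have := congrArg star H
  rw [star_mul, star_star, star_sum] at this
  rw [this]
  refine Finset.sum_bij (fun p _ => p.swap) ?_ ?_ ?_ ?_
  · intro p hp
    simp only [Set.Finite.mem_toFinset] at hp ⊢
    exact Λ.minExt_swap hp
  · intro p _ q _ hpq
    exact Prod.swap_injective hpq
  · intro p hp
    simp only [Set.Finite.mem_toFinset] at hp
    exact ⟨p.swap, by simpa using Λ.minExt_swap hp, Prod.swap_swap p⟩
  · intro p _
    simp

/-- Expand `S_{μ₂}* (S_{μ₁}* S_ν)` from the inside out; the double sum is the one in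
`sum_minExt_comp`. -/
theorem star_mul_comp (h : Λ.EdgeRelations S) (hΛ : Λ.FinitelyAligned) {μ₁ μ₂ μ ν : Arrow V}
    (H : IsComp μ₁ μ₂ μ)
    (h1 : star (S μ₁) * S ν = ∑ p ∈ (hΛ μ₁ ν).toFinset, S p.1 * star (S p.2))
    (h2 : ∀ p ∈ Λ.minExt μ₁ ν,
      star (S μ₂) * S p.1 = ∑ r ∈ (hΛ μ₂ p.1).toFinset, S r.1 * star (S r.2)) :
    star (S μ) * S ν = ∑ p ∈ (hΛ μ ν).toFinset, S p.1 * star (S p.2) := by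
  rw [sum_minExt_comp hΛ H ν (fun γ δ => S γ * star (S δ)), h.comp _ _ _ H, star_mul, mul_assoc, h1,
    Finset.mul_sum]
  refine Finset.sum_congr rfl fun p hp => ?_
  simp only [Set.Finite.mem_toFinset] at hp
  rw [← mul_assoc, h2 p hp, Finset.sum_mul]
  refine Finset.sum_congr rfl fun r hr => ?_
  simp only [Set.Finite.mem_toFinset] at hr
  rw [h.comp _ _ _ (minExt_comp_mem H hp hr).1, star_mul, mul_assoc]

/-- The `S (g q) * star (S (g q))` are mutually orthogonal projections below `S_a`, so the
difference is the complement of their sum. -/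
theorem star_mul_compl (h : Λ.EdgeRelations S) {F : Finset (Arrow V × Arrow V)}
    {g : Arrow V × Arrow V → Arrow V} {a : V} {n : Fin k → ℕ}
    (hg : ∀ p ∈ F, ∃ α : Λ.Edge, α.path = g p ∧ Λ.deg α.path = n)
    (hr : ∀ p ∈ F, (g p).right = a) (hinj : ∀ p ∈ F, ∀ q ∈ F, g p = g q → p = q)
    {p : Arrow V × Arrow V} (hp : p ∈ F) :
    star (S (g p)) * (S (vertexPath a) - ∑ q ∈ F, S (g q) * star (S (g q))) = 0 := by
  rw [mul_sub, Finset.mul_sum, Finset.sum_eq_single p]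
  · obtain ⟨α, hα, -⟩ := hg p hp
    have h1 := h.star_mul_self α
    rw [hα] at h1
    have h2 : α.src = (g p).left := by rw [← hα]; rfl
    rw [← mul_assoc, h1, h2, h.vertex_mul_star, ← hr p hp, h.star_mul_vertex, sub_self]
  · intro q hq hqp
    obtain ⟨α, hα, hα'⟩ := hg p hp
    obtain ⟨β, hβ, hβ'⟩ := hg q hq
    rw [← mul_assoc, ← hα, ← hβ, h.star_mul_of_deg_eq α β _ (hα'.trans hβ'.symm), zero_mul]
    rintro rfl
    exact hqp (hinj q hq p hp (hβ.symm.trans hα))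
  · exact fun hn => absurd hp hn

/-- For different degrees and equal ranges, let `x` and `y` be the complements of the range
projections of the `α` and of the `β`. The disjointness relation gives `x S_μ* S_ν y = 0`, the
squares `μα = νβ` upgrade this to `S_μ* S_ν y = 0`, and expanding `y` yields the formula. -/
theorem star_edge_mul_edge (h : Λ.EdgeRelations S) (hΛ : Λ.FinitelyAligned) (μ ν : Λ.Edge) :
    star (S μ.path) * S ν.path =
      ∑ p ∈ (hΛ μ.path ν.path).toFinset, S p.1 * star (S p.2) := by
  by_cases hd : Λ.deg μ.path = Λ.deg ν.path
  · by_cases he : μ = ν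
    · subst he
      have h1 : (hΛ μ.path μ.path).toFinset =
          {(vertexPath μ.path.left, vertexPath μ.path.left)} := by
        apply Finset.coe_injective
        simpa using minExt_self μ.path
      have h2 : star (S μ.path) * S μ.path = S (vertexPath μ.path.left) := h.star_mul_self μ
      rw [h1, Finset.sum_singleton, h2, h.vertex_selfAdjoint, h.vertex_idempotent]
    · rw [h.star_mul_of_deg_eq μ ν he hd, Finset.sum_eq_zero]
      intro p hp
      simp only [Set.Finite.mem_toFinset] at hp
      exact absurd (edge_ext (minExt_of_deg_eq hd hp).1) he
  by_cases hr : μ.rng = ν.rng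
  swap
  · rw [h.star_mul_of_right_ne (μ := μ.path) (ν := ν.path) hr, Finset.sum_eq_zero]
    intro p hp
    exact absurd (minExt_right_eq ((Set.Finite.mem_toFinset _).1 hp)) hr
  set F := (hΛ μ.path ν.path).toFinset with hF
  have hmem : ∀ p, p ∈ F ↔ p ∈ Λ.minExt μ.path ν.path := fun p => by simp [hF]
  set x := S (vertexPath μ.src) - ∑ q ∈ F, S q.1 * star (S q.1) with hx
  set y := S (vertexPath ν.src) - ∑ q ∈ F, S q.2 * star (S q.2) with hy
  have hx0 : ∀ p ∈ F, star (S p.1) * x = 0 := fun p hp =>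
    h.star_mul_compl (g := Prod.fst) (fun p hp => exists_edge_fst hd ((hmem p).1 hp))
      (fun p hp => minExt_fst_right ((hmem p).1 hp))
      (fun p hp q hq e => Prod.ext e (minExt_snd_eq ((hmem p).1 hp) ((hmem q).1 hq) e)) hp
  have hy0 : ∀ p ∈ F, star (S p.2) * y = 0 := fun p hp =>
    h.star_mul_compl (g := Prod.snd) (fun p hp => exists_edge_snd hd ((hmem p).1 hp))
      (fun p hp => minExt_snd_right ((hmem p).1 hp))
      (fun p hp q hq e => Prod.ext (minExt_fst_eq ((hmem p).1 hp) ((hmem q).1 hq) e) e) hp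
  have hxs : star x = x := by
    simp [hx, star_sum, h.vertex_selfAdjoint]
  have hcomp : ∀ p ∈ F, S μ.path * S p.1 = S ν.path * S p.2 := by
    intro p hp
    obtain ⟨lam, h1, h2, -⟩ := (hmem p).1 hp
    rw [← h.comp _ _ _ h1, ← h.comp _ _ _ h2]
  have key := h.star_mul_of_deg_ne μ ν hr hd x y
    (fun α ⟨β, hαβ⟩ => hx0 (α.path, β) ((hmem _).2 hαβ))
    (fun β ⟨α, hαβ⟩ => hy0 (α, β.path) ((hmem _).2 hαβ))
  have hν : star (S ν.path) * S ν.path = S (vertexPath ν.src) := h.star_mul_self ν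
  have hμ : star (S μ.path) * S μ.path = S (vertexPath μ.src) := h.star_mul_self μ
  -- Here `S_α* S_μ* S_ν y = S_β* S_ν* S_ν y = S_β* y = 0`, so `x` may be replaced by `S_{s(μ)}` in
  -- `key`.
  have h1 : ∀ p ∈ F, star (S p.1) * (star (S μ.path) * (S ν.path * y)) = 0 := by
    intro p hp
    have h3 : S (vertexPath ν.src) = S (vertexPath p.2.right) := by
      rw [minExt_snd_right ((hmem p).1 hp)]; rfl
    rw [← mul_assoc, ← star_mul, hcomp p hp, star_mul, mul_assoc, ← mul_assoc (star (S ν.path)), hν,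
      h3, ← mul_assoc, h.star_mul_vertex, hy0 p hp]
  have h2 : star (S μ.path) * (S ν.path * y) = 0 := by
    rw [star_mul, hxs, mul_assoc] at key
    nth_rewrite 1 [hx] at key
    rw [sub_mul, Finset.sum_mul, Finset.sum_eq_zero (s := F), sub_zero, ← mul_assoc] at key
    · have := h.vertex_mul_star μ.path
      change S (vertexPath μ.src) * _ = _ at this
      rwa [this] at key
    · intro p hp
      rw [mul_assoc, h1 p hp, mul_zero]
  have h3 : S ν.path * S (vertexPath ν.src) = S ν.path := h.mul_vertex ν.path
  rw [hy, mul_sub, h3, mul_sub, sub_eq_zero] at h2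
  rw [h2, Finset.mul_sum, Finset.mul_sum]
  refine Finset.sum_congr rfl fun p hp => ?_
  have h4 : S (vertexPath μ.src) = S (vertexPath p.1.right) := by
    rw [minExt_fst_right ((hmem p).1 hp)]; rfl
  rw [← mul_assoc (S ν.path), ← hcomp p hp, ← mul_assoc, ← mul_assoc, hμ, h4, h.vertex_mul]

/-- Take adjoints so that the long path `ν = gν'` stands on the left. Completing the edge `μ`
against `g` leaves a vertex or a single edge to be compared with the shorter `ν'`, so the induction
closes. -/
theorem star_edge_mul (h : Λ.EdgeRelations S) (hΛ : Λ.FinitelyAligned) (n : ℕ) :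
    ∀ (μ : Λ.Edge) (ν : Arrow V), Λ.length ν = n →
      star (S μ.path) * S ν = ∑ p ∈ (hΛ μ.path ν).toFinset, S p.1 * star (S p.2) := by
  induction n with
  | zero =>
    intro μ ν hn
    rw [Λ.eq_vertexPath (Λ.deg_eq_zero_of_length hn)]
    exact star_mul_symm hΛ (h.star_mul_vertexPath hΛ _ _)
  | succ m ih =>
    intro μ ν hn
    have h0 : Λ.deg ν ≠ 0 := by
      intro h0
      simp [length, h0] at hn
    obtain ⟨g, ν', hg⟩ := Λ.exists_first_edge h0
    have hl := Λ.length_eq_of_isComp hg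
    rw [length_edge] at hl
    refine star_mul_symm hΛ (h.star_mul_comp hΛ hg (h.star_edge_mul_edge hΛ g μ) fun p hp => ?_)
    apply star_mul_symm
    by_cases hd : Λ.deg g.path = Λ.deg μ.path
    · rw [(minExt_of_deg_eq hd hp).2]
      exact h.star_mul_vertexPath hΛ _ _
    · obtain ⟨α, hα, -⟩ := exists_edge_fst hd hp
      rw [← hα]
      exact ih α ν' (by omega)

theorem star_mul (h : Λ.EdgeRelations S) (hΛ : Λ.FinitelyAligned) (n : ℕ) :
    ∀ (μ ν : Arrow V), Λ.length μ = n →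
      star (S μ) * S ν = ∑ p ∈ (hΛ μ ν).toFinset, S p.1 * star (S p.2) := by
  induction n with
  | zero =>
    intro μ ν hn
    rw [Λ.eq_vertexPath (Λ.deg_eq_zero_of_length hn)]
    exact h.star_mul_vertexPath hΛ _ _
  | succ m ih =>
    intro μ ν hn
    have h0 : Λ.deg μ ≠ 0 := by
      intro h0
      simp [length, h0] at hn
    obtain ⟨g, μ', hg⟩ := Λ.exists_first_edge h0
    have hl := Λ.length_eq_of_isComp hg
    rw [length_edge] at hl
    exact h.star_mul_comp hΛ hg (h.star_edge_mul hΛ _ g ν rfl) fun p _ => ih μ' p.1 (by omega)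

theorem star_mul_self_path (h : Λ.EdgeRelations S) (hΛ : Λ.FinitelyAligned) (μ : Arrow V) :
    star (S μ) * S μ = S (vertexPath μ.left) := by
  have : (hΛ μ μ).toFinset = {(vertexPath μ.left, vertexPath μ.left)} := by
    apply Finset.coe_injective
    simpa using minExt_self μ
  rw [h.star_mul hΛ _ μ μ rfl, this, Finset.sum_singleton, h.vertex_selfAdjoint,
    h.vertex_idempotent]

theorem mul_star_mul_self (h : Λ.EdgeRelations S) (hΛ : Λ.FinitelyAligned) (μ : Arrow V) :
    S μ * star (S μ) * S μ = S μ := by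
  rw [mul_assoc, h.star_mul_self_path hΛ, h.mul_vertex]

/-- The product is the sum of the `S_λ S_λ*` over the minimal common extensions `λ`, hence
self-adjoint; taking adjoints reverses the factors. -/
theorem rangeProj_commute (h : Λ.EdgeRelations S) (hΛ : Λ.FinitelyAligned) (μ ν : Arrow V) :
    S μ * star (S μ) * (S ν * star (S ν)) = S ν * star (S ν) * (S μ * star (S μ)) := by
  have key : star (S μ * star (S μ) * (S ν * star (S ν))) =
      S μ * star (S μ) * (S ν * star (S ν)) := by
    have e : S μ * star (S μ) * (S ν * star (S ν)) =
        ∑ p ∈ (hΛ μ ν).toFinset, S μ * S p.1 * star (S ν * S p.2) := by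
      rw [mul_assoc, ← mul_assoc (star (S μ)), h.star_mul hΛ _ μ ν rfl, Finset.sum_mul,
        Finset.mul_sum]
      refine Finset.sum_congr rfl fun p _ => ?_
      simp only [StarMul.star_mul, mul_assoc]
    rw [e, star_sum]
    refine Finset.sum_congr rfl fun p hp => ?_
    obtain ⟨lam, h1, h2, -⟩ := (Set.Finite.mem_toFinset _).1 hp
    rw [← h.comp _ _ _ h1, ← h.comp _ _ _ h2]
    simp only [StarMul.star_mul, star_star]
  rw [← key]
  simp only [StarMul.star_mul, star_star]

/-- Induction on the total of a coordinatewise bound `N` for the degrees in `E`. The first edges of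
`E` form an exhaustive set, so it is enough that `S_e* x = 0` for each of them. This follows by
induction at `s(e)`, where the extensions of `e` towards `E` are exhaustive and of degree at most `N
- d(e)`. -/
theorem vertex_mul_eq_zero (h : Λ.EdgeRelations S) (hΛ : Λ.FinitelyAligned) (n : ℕ) :
    ∀ (N : Fin k → ℕ), ∑ i, N i = n → ∀ (a : V) (E : Set (Arrow V)), E.Finite →
      Λ.Exhaustive a E → (∀ lam ∈ E, Λ.deg lam ≤ N) →
      ∀ x : B, (∀ lam ∈ E, star (S lam) * x = 0) → S (vertexPath a) * x = 0 := by
  induction n using Nat.strong_induction_on with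
  | _ n ih =>
  intro N hN a E hfin hE hdeg x hx
  by_cases h0 : ∃ lam ∈ E, Λ.deg lam = 0
  · obtain ⟨lam, hl, hl0⟩ := h0
    have := hx lam hl
    rwa [Λ.eq_vertexPath_right hl0, h.vertex_selfAdjoint, hE.1 lam hl] at this
  push Not at h0
  have hfe : ∀ lam : E, ∃ (μ : Λ.Edge) (ν : Arrow V), IsComp μ.path ν lam.1 :=
    fun lam => Λ.exists_first_edge (h0 lam.1 lam.2)
  choose g ν hg using hfe
  have hIfin : (Set.range g).Finite := by
    have := hfin.to_subtype
    exact Set.finite_range g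
  refine h.exhaustive a hIfin.toFinset ⟨?_, ?_⟩ x ?_
  · rintro _ ⟨e, he, rfl⟩
    simp only [Set.Finite.coe_toFinset, Set.mem_range] at he
    obtain ⟨lam, rfl⟩ := he
    rw [← (hg lam).right_eq]
    exact hE.1 lam.1 lam.2
  -- Initial segments of an exhaustive set are exhaustive: a common extension with a path is one
  -- with its first edge.
  · intro μ hμ
    obtain ⟨lam, hl, p, τ, h1, h2, -⟩ := hE.2 μ hμ
    obtain ⟨ρ, -, h3⟩ := (hg ⟨lam, hl⟩).assoc h2
    obtain ⟨q, hq, -⟩ := Λ.exists_minExt h1 h3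
    exact ⟨(g ⟨lam, hl⟩).path, ⟨_, by simp, rfl⟩, q, hq⟩
  · intro e he
    simp only [Set.Finite.mem_toFinset, Set.mem_range] at he
    obtain ⟨lam0, rfl⟩ := he
    set e := g lam0
    obtain ⟨i, hi⟩ := e.2
    change Λ.deg e.path = _ at hi
    have hNi : 1 ≤ N i := by
      have h1 := hdeg lam0.1 lam0.2 i
      rw [Λ.deg_eq_of_isComp (hg lam0), hi] at h1
      simp only [Pi.add_apply, Pi.single_eq_same] at h1
      omega
    have hle : Pi.single i 1 ≤ N := by
      intro j
      by_cases hj : j = i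
      · subst hj; simpa using hNi
      · simp [hj]
    have hsum : ∑ j, (N - Pi.single i 1 : Fin k → ℕ) j + 1 = n := by
      have h1 : ∑ j, (N - Pi.single i 1 : Fin k → ℕ) j + ∑ j, (Pi.single i 1 : Fin k → ℕ) j = n := by
        rw [← Finset.sum_add_distrib, ← hN]
        refine Finset.sum_congr rfl fun j _ => ?_
        exact Nat.sub_add_cancel (hle j)
      simpa using h1
    have key := ih _ (by omega) (N - Pi.single i 1) rfl e.src
      (⋃ lam ∈ E, Prod.fst '' Λ.minExt e.path lam)
      (hfin.biUnion fun lam _ => (hΛ e.path lam).image _) ⟨?_, ?_⟩ ?_ (star (S e.path) * x) ?_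
    · rw [← mul_assoc] at key
      have h1 := h.vertex_mul_star e.path
      change S (vertexPath e.src) * _ = _ at h1
      rwa [h1] at key
    · intro α hα
      simp only [Set.mem_iUnion, Set.mem_image] at hα
      obtain ⟨lam, hl, p, hp, rfl⟩ := hα
      exact minExt_fst_right hp
    -- Test the path `eα` against `E`, then cancel `e` from the common extension found.
    · intro α hα
      obtain ⟨τ, hτ⟩ := exists_isComp (μ := e.path) (ν := α) hα
      have hr : τ.right = a := by
        rw [hτ.right_eq, ← (hg lam0).right_eq]
        exact hE.1 _ lam0.2
      obtain ⟨lam, hl, q, ρ, h1, h2, -⟩ := hE.2 τ hr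
      obtain ⟨ω, h3, h4⟩ := hτ.assoc h1
      obtain ⟨p, hp, δ, h5, -⟩ := Λ.exists_minExt h4 h2
      obtain ⟨r, hr, -⟩ := Λ.exists_minExt h3 h5
      refine ⟨p.1, ?_, r, hr⟩
      simp only [Set.mem_iUnion]
      exact ⟨lam, hl, p, hp, rfl⟩
    · intro α hα
      simp only [Set.mem_iUnion, Set.mem_image] at hα
      obtain ⟨lam, hl, p, hp, rfl⟩ := hα
      rw [minExt_deg_fst hp, hi]
      exact tsub_le_tsub_right (hdeg lam hl) _
    -- If `eα = λβ` then `S_α* S_e* x = S_β* S_λ* x = 0`.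
    · intro α hα
      simp only [Set.mem_iUnion, Set.mem_image] at hα
      obtain ⟨lam, hl, p, hp, rfl⟩ := hα
      obtain ⟨τ, h1, h2, -⟩ := hp
      rw [← mul_assoc, ← StarMul.star_mul, ← h.comp _ _ _ h1, h.comp _ _ _ h2, StarMul.star_mul,
        mul_assoc, hx lam hl, mul_zero]

/-- With `Q` the product over the list, `Q = S_a Q` and every `S_μ*` kills `Q`; so
`vertex_mul_eq_zero`, applied to `Q` itself, gives `Q = 0`. -/
theorem star_mul_foldr (h : Λ.EdgeRelations S) (hΛ : Λ.FinitelyAligned) {a : V}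
    (l : List (Arrow V)) (hl : ∀ μ ∈ l, μ.right = a) :
    S (vertexPath a) * l.foldr (fun μ b => (S (vertexPath a) - S μ * star (S μ)) * b)
        (S (vertexPath a)) =
      l.foldr (fun μ b => (S (vertexPath a) - S μ * star (S μ)) * b) (S (vertexPath a)) ∧
    ∀ μ ∈ l, star (S μ) * l.foldr (fun μ b => (S (vertexPath a) - S μ * star (S μ)) * b)
      (S (vertexPath a)) = 0 := by
  induction l with
  | nil => exact ⟨h.vertex_idempotent a, by simp⟩
  | cons ν l ih =>
    obtain ⟨ih1, ih2⟩ := ih fun μ hμ => hl μ (List.mem_cons_of_mem _ hμ)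
    rw [List.foldr_cons]
    set Q := l.foldr (fun μ b => (S (vertexPath a) - S μ * star (S μ)) * b) (S (vertexPath a))
    have hν : ν.right = a := hl ν List.mem_cons_self
    have h1 := h.vertex_mul ν
    have h2 := h.star_mul_vertex ν
    rw [hν] at h1 h2
    have h3 : star (S ν) * S ν * star (S ν) = star (S ν) := by
      rw [h.star_mul_self_path hΛ, h.vertex_mul_star]
    refine ⟨?_, ?_⟩
    · rw [← mul_assoc, mul_sub, h.vertex_idempotent, ← mul_assoc, h1]
    · intro μ hμ
      rcases List.mem_cons.1 hμ with rfl | hμ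
      · rw [← mul_assoc, mul_sub, h2, ← mul_assoc, h3, sub_self, zero_mul]
      · have e1 := ih2 μ hμ
        -- Writing `S_μ*` as `S_μ* (S_μ S_μ*)` allows the range projection to commute past the new
        -- factor and reach the tail, which it kills.
        have e2 : star (S μ) * (S μ * star (S μ)) = star (S μ) := by
          rw [← mul_assoc, h.star_mul_self_path hΛ, h.vertex_mul_star]
        rw [sub_mul, ih1, mul_sub, e1, zero_sub, neg_eq_zero, ← e2, mul_assoc,
          ← mul_assoc (S μ * star (S μ)), h.rangeProj_commute hΛ μ ν, mul_assoc, mul_assoc (S μ),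
          e1]
        simp

theorem isCKFamily (h : Λ.EdgeRelations S) (hΛ : Λ.FinitelyAligned) : Λ.IsCKFamily S where
  partialIsometry := h.mul_star_mul_self hΛ
  vertex_selfAdjoint := h.vertex_selfAdjoint
  vertex_idempotent := h.vertex_idempotent
  vertex_orthogonal := h.vertex_orthogonal
  comp := h.comp
  star_mul_eq μ ν := by
    rw [h.star_mul hΛ _ μ ν rfl, finsum_mem_eq_finite_toFinset_sum _ (hΛ μ ν)]
  exhaustive a l _ hl := by
    obtain ⟨h1, h2⟩ := h.star_mul_foldr hΛ l hl.1
    rw [← h1]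
    have hfin : {μ | μ ∈ l}.Finite := List.finite_toSet l
    -- The join of all degrees in the list serves as the bound `N`.
    refine h.vertex_mul_eq_zero hΛ _ (hfin.toFinset.sup Λ.deg) rfl a _ hfin hl ?_ _ h2
    intro lam hlam
    exact Finset.le_sup (f := Λ.deg) (by simpa using hlam)

end EdgeRelations

end KGraph

/-! ### Operators on `L²` -/

section LpTwo

variable {X : Type*} [MeasurableSpace X] {η : Measure X}

theorem eLpNorm_two_sq (φ : X → ℂ) : eLpNorm φ 2 η ^ 2 = ∫⁻ x, ‖φ x‖ₑ ^ 2 ∂η := by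
  simpa using eLpNorm_nnreal_pow_eq_lintegral (f := φ) (μ := η) (p := 2) two_ne_zero

theorem eLpNorm_two_le_iff {φ ψ : X → ℂ} :
    eLpNorm φ 2 η ≤ eLpNorm ψ 2 η ↔ ∫⁻ x, ‖φ x‖ₑ ^ 2 ∂η ≤ ∫⁻ x, ‖ψ x‖ₑ ^ 2 ∂η := by
  rw [← eLpNorm_two_sq, ← eLpNorm_two_sq, ENNReal.pow_le_pow_left_iff two_ne_zero]

theorem memLp_two_of_lintegral_le {φ ψ : X → ℂ} (hφ : AEStronglyMeasurable φ η)
    (hψ : MemLp ψ 2 η) (h : ∫⁻ x, ‖φ x‖ₑ ^ 2 ∂η ≤ ∫⁻ x, ‖ψ x‖ₑ ^ 2 ∂η) : MemLp φ 2 η :=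
  ⟨hφ, (eLpNorm_two_le_iff.2 h).trans_lt hψ.2⟩

theorem Lp_two_norm_eq {φ ψ : Lp ℂ 2 η}
    (h : ∫⁻ x, ‖φ x‖ₑ ^ 2 ∂η = ∫⁻ x, ‖ψ x‖ₑ ^ 2 ∂η) : ‖φ‖ = ‖ψ‖ := by
  rw [Lp.norm_def, Lp.norm_def, le_antisymm (eLpNorm_two_le_iff.2 h.le) (eLpNorm_two_le_iff.2 h.ge)]

/-- A contraction of `L²` given by an operation on functions. -/
noncomputable def lpTwoOperator (G : (X → ℂ) → X → ℂ) (hG : ∀ φ : Lp ℂ 2 η, MemLp (G φ) 2 η)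
    (hadd : ∀ φ ψ : Lp ℂ 2 η, G ↑(φ + ψ) =ᵐ[η] G φ + G ψ)
    (hsmul : ∀ (c : ℂ) (φ : Lp ℂ 2 η), G ↑(c • φ) =ᵐ[η] c • G φ)
    (hle : ∀ φ : Lp ℂ 2 η, ∫⁻ x, ‖G φ x‖ₑ ^ 2 ∂η ≤ ∫⁻ x, ‖φ x‖ₑ ^ 2 ∂η) :
    Lp ℂ 2 η →L[ℂ] Lp ℂ 2 η :=
  LinearMap.mkContinuous
    { toFun := fun φ => (hG φ).toLp
      map_add' := fun φ ψ => by
        rw [← MemLp.toLp_add]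
        exact MemLp.toLp_congr _ _ (hadd φ ψ)
      map_smul' := fun c φ => by
        rw [RingHom.id_apply, ← MemLp.toLp_const_smul]
        exact MemLp.toLp_congr _ _ (hsmul c φ) } 1 fun φ => by
    rw [one_mul]
    change ‖(hG φ).toLp‖ ≤ ‖φ‖
    rw [Lp.norm_toLp, Lp.norm_def]
    exact ENNReal.toReal_mono (Lp.memLp φ).2.ne (eLpNorm_two_le_iff.2 (hle φ))

theorem lpTwoOperator_coeFn {G : (X → ℂ) → X → ℂ} {hG : ∀ φ : Lp ℂ 2 η, MemLp (G φ) 2 η}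
    {hadd : ∀ φ ψ : Lp ℂ 2 η, G ↑(φ + ψ) =ᵐ[η] G φ + G ψ}
    {hsmul : ∀ (c : ℂ) (φ : Lp ℂ 2 η), G ↑(c • φ) =ᵐ[η] c • G φ}
    {hle : ∀ φ : Lp ℂ 2 η, ∫⁻ x, ‖G φ x‖ₑ ^ 2 ∂η ≤ ∫⁻ x, ‖φ x‖ₑ ^ 2 ∂η} (φ : Lp ℂ 2 η) :
    (lpTwoOperator G hG hadd hsmul hle φ : X → ℂ) =ᵐ[η] G φ :=
  MemLp.coeFn_toLp (hG φ)

/-- Multiplication by the characteristic function of a measurable set, as an operator on `L²`. -/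
noncomputable def chi (η : Measure X) {A : Set X} (hA : MeasurableSet A) :
    Lp ℂ 2 η →L[ℂ] Lp ℂ 2 η :=
  lpTwoOperator A.indicator (fun φ => (Lp.memLp φ).indicator hA)
    (fun φ ψ => by
      filter_upwards [Lp.coeFn_add φ ψ] with x hx
      rw [Pi.add_apply] at hx ⊢
      by_cases hxA : x ∈ A
      · simp only [Set.indicator_of_mem hxA, hx]
      · simp only [Set.indicator_of_notMem hxA, add_zero])
    (fun c φ => by
      filter_upwards [Lp.coeFn_smul c φ] with x hx
      by_cases hxA : x ∈ A <;> simp [hxA, hx])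
    (fun φ => by
      refine lintegral_mono fun x => ?_
      by_cases hxA : x ∈ A <;> simp [hxA])

variable {A B : Set X} {hA : MeasurableSet A} {hB : MeasurableSet B}

theorem chi_coeFn (φ : Lp ℂ 2 η) : (chi η hA φ : X → ℂ) =ᵐ[η] A.indicator φ :=
  lpTwoOperator_coeFn φ

theorem chi_eq_zero_iff (φ : Lp ℂ 2 η) : chi η hA φ = 0 ↔ ∀ᵐ x ∂η, x ∈ A → φ x = 0 := by
  rw [Lp.eq_zero_iff_ae_eq_zero]
  constructor
  · intro h
    filter_upwards [h, chi_coeFn (hA := hA) φ] with x h1 h2 hx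
    rw [h1, Set.indicator_of_mem hx] at h2
    exact h2.symm
  · intro h
    filter_upwards [h, chi_coeFn (hA := hA) φ] with x h1 h2
    rw [h2]
    by_cases hx : x ∈ A
    · rw [Set.indicator_of_mem hx, h1 hx]; rfl
    · rw [Set.indicator_of_notMem hx]; rfl

theorem chi_eq_self_iff (φ : Lp ℂ 2 η) : chi η hA φ = φ ↔ ∀ᵐ x ∂η, x ∉ A → φ x = 0 := by
  constructor
  · intro h
    have := chi_coeFn (hA := hA) φ
    rw [h] at this
    filter_upwards [this] with x h2 hx
    rwa [Set.indicator_of_notMem hx] at h2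
  · intro h
    apply Lp.ext
    filter_upwards [h, chi_coeFn (hA := hA) φ] with x h1 h2
    rw [h2]
    by_cases hx : x ∈ A
    · rw [Set.indicator_of_mem hx]
    · rw [Set.indicator_of_notMem hx, h1 hx]

theorem chi_idempotent : chi η hA * chi η hA = chi η hA := by
  ext1 φ
  refine (chi_eq_self_iff (hA := hA) (chi η hA φ)).2 ?_
  filter_upwards [chi_coeFn (hA := hA) φ] with x h2 hx
  rw [h2, Set.indicator_of_notMem hx]

theorem chi_mul_eq_zero (h : η (A ∩ B) = 0) : chi η hA * chi η hB = 0 := by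
  ext1 φ
  refine (chi_eq_zero_iff (hA := hA) (chi η hB φ)).2 ?_
  filter_upwards [chi_coeFn (hA := hB) φ, measure_eq_zero_iff_ae_notMem.1 h] with x h2 h3 hx
  rw [h2, Set.indicator_of_notMem fun hxB => h3 ⟨hx, hxB⟩]

theorem inner_eq_zero_of_ae {φ ψ : Lp ℂ 2 η} (h : ∀ᵐ x ∂η, φ x = 0 ∨ ψ x = 0) :
    inner ℂ φ ψ = 0 := by
  rw [L2.inner_def]
  refine integral_eq_zero_of_ae ?_
  filter_upwards [h] with x hx
  rcases hx with hx | hx <;> simp [hx]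

theorem star_chi : star (chi η hA) = chi η hA := by
  rw [ContinuousLinearMap.star_eq_adjoint]
  symm
  rw [ContinuousLinearMap.eq_adjoint_iff]
  intro φ ψ
  rw [L2.inner_def, L2.inner_def]
  refine integral_congr_ae ?_
  filter_upwards [chi_coeFn (hA := hA) φ, chi_coeFn (hA := hA) ψ] with x h1 h2
  rw [h1, h2]
  by_cases hx : x ∈ A <;> simp [hx]

theorem star_mul_eq_of_inner {H : Type*} [NormedAddCommGroup H] [InnerProductSpace ℂ H]
    [CompleteSpace H] {P Q : H →L[ℂ] H} (h : ∀ φ ψ, inner ℂ (P φ) (Q ψ) = 0) : star P * Q = 0 := by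
  ext1 ψ
  refine ext_inner_left ℂ fun φ => ?_
  rw [mul_apply_eq_comp, ContinuousLinearMap.star_eq_adjoint,
    ContinuousLinearMap.adjoint_inner_right, h]
  simp

/-- Complex polarization: an operator is determined by its quadratic form. -/
theorem star_mul_self_eq_of_norm {H : Type*} [NormedAddCommGroup H] [InnerProductSpace ℂ H]
    [CompleteSpace H] {P Q : H →L[ℂ] H} (h : ∀ φ, ‖P φ‖ = ‖Q φ‖) : star P * P = star Q * Q := by
  apply ContinuousLinearMap.coe_injective
  rw [← ext_inner_map]
  intro φ
  simp only [ContinuousLinearMap.coe_coe, mul_apply_eq_comp,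
    ContinuousLinearMap.star_eq_adjoint, ContinuousLinearMap.adjoint_inner_left,
    inner_self_eq_norm_sq_to_K, h]

/-- Continuous linear maps on `L²` that agree on nonnegative functions are equal. -/
theorem lpTwo_ext_of_nonneg {P Q : Lp ℂ 2 η →L[ℂ] Lp ℂ 2 η}
    (h : ∀ φ : Lp ℂ 2 η, (∀ᵐ x ∂η, φ x = (‖φ x‖ : ℂ)) → P φ = Q φ) : P = Q := by
  ext1 φ
  induction φ using Lp.induction (p := 2) (by simp) with
  | indicatorConst c hs hμs =>
    rw [Lp.simpleFunc.coe_indicatorConst]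
    -- By density and linearity only indicator functions remain, and these are nonnegative once the
    -- scalar is taken out.
    have e : indicatorConstLp (μ := η) 2 hs hμs.ne c = c • indicatorConstLp 2 hs hμs.ne (1 : ℂ) := by
      apply Lp.ext
      filter_upwards [indicatorConstLp_coeFn (p := 2) (hs := hs) (hμs := hμs.ne) (c := c),
        indicatorConstLp_coeFn (p := 2) (hs := hs) (hμs := hμs.ne) (c := (1 : ℂ)),
        Lp.coeFn_smul c (indicatorConstLp (μ := η) 2 hs hμs.ne (1 : ℂ))] with x h1 h2 h3
      rw [h1, h3, Pi.smul_apply, h2]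
      simp only [Set.indicator]
      split_ifs <;> simp
    rw [e, map_smul, map_smul, h]
    filter_upwards [indicatorConstLp_coeFn (p := 2) (hs := hs) (hμs := hμs.ne) (c := (1 : ℂ))]
      with x h2
    rw [h2]
    simp only [Set.indicator]
    split_ifs <;> simp
  | add hf hg _ h1 h2 => rw [map_add, map_add, h1, h2]
  | isClosed => exact isClosed_eq P.continuous Q.continuous

end LpTwo

/-! ### The operators of a branching system -/

namespace KGraph.BranchingSystem

variable {k : ℕ} {V : Type u} [Category.{v} V] {Λ : KGraph k V}
  {X : Type w} [MeasurableSpace X] {η : Measure X} (S : Λ.BranchingSystem η)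

theorem aemeasurable_f (μ : Λ.Edge) : AEMeasurable (S.f μ) (η.restrict (S.D μ.src)) :=
  aemeasurable_restrict_of_measurable_subtype (S.measurableSet_D _) (S.measurable_f μ)

theorem aemeasurable_fInv (μ : Λ.Edge) : AEMeasurable (S.fInv μ) (η.restrict (S.R μ)) :=
  aemeasurable_restrict_of_measurable_subtype (S.measurableSet_R _) (S.measurable_fInv μ)

/-- Absolute continuity makes preimages of null sets null, so composition with `f_μ⁻¹` respects
almost everywhere equality. -/
theorem ae_fInv (μ : Λ.Edge) {p : X → Prop} (h : ∀ᵐ x ∂(η.restrict (S.D μ.src)), p x) :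
    ∀ᵐ x ∂(η.restrict (S.R μ)), p (S.fInv μ x) :=
  ae_of_ae_map (S.aemeasurable_fInv μ) ((S.absolutelyContinuous_f μ).ae_le h)

theorem ae_f (μ : Λ.Edge) {p : X → Prop} (h : ∀ᵐ x ∂(η.restrict (S.R μ)), p x) :
    ∀ᵐ x ∂(η.restrict (S.D μ.src)), p (S.f μ x) :=
  ae_of_ae_map (S.aemeasurable_f μ) ((S.absolutelyContinuous_fInv μ).ae_le h)

theorem aemeasurable_comp_f (μ : Λ.Edge) {E : Type*} [MeasurableSpace E] {φ : X → E}
    (hφ : AEMeasurable φ (η.restrict (S.R μ))) :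
    AEMeasurable (fun x => φ (S.f μ x)) (η.restrict (S.D μ.src)) :=
  (hφ.mono_ac (S.absolutelyContinuous_fInv μ)).comp_aemeasurable (S.aemeasurable_f μ)

theorem aemeasurable_comp_fInv (μ : Λ.Edge) {E : Type*} [MeasurableSpace E] {φ : X → E}
    (hφ : AEMeasurable φ (η.restrict (S.D μ.src))) :
    AEMeasurable (fun x => φ (S.fInv μ x)) (η.restrict (S.R μ)) :=
  (hφ.mono_ac (S.absolutelyContinuous_f μ)).comp_aemeasurable (S.aemeasurable_fInv μ)

theorem measurable_Phi (μ : Λ.Edge) : Measurable (S.Phi μ) := Measure.measurable_rnDeriv _ _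

/-- The operation `φ ↦ Φ_{f_μ⁻¹}^{1/2} (φ ∘ f_μ⁻¹)` on functions. -/
noncomputable def pull (μ : Λ.Edge) (φ : X → ℂ) : X → ℂ :=
  (S.R μ).indicator (fun x => (Real.sqrt (S.Phi μ x).toReal : ℂ) * φ (S.fInv μ x))

theorem pull_aestronglyMeasurable (μ : Λ.Edge) {φ : X → ℂ} (hφ : AEStronglyMeasurable φ η) :
    AEStronglyMeasurable (S.pull μ φ) η := by
  rw [pull, aestronglyMeasurable_indicator_iff (S.measurableSet_R μ)]
  apply AEMeasurable.aestronglyMeasurable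
  refine AEMeasurable.mul ?_ (S.aemeasurable_comp_fInv μ hφ.aemeasurable.restrict)
  have := S.measurable_Phi μ
  fun_prop

theorem pull_ae_add (μ : Λ.Edge) (φ ψ : Lp ℂ 2 η) :
    S.pull μ ↑(φ + ψ) =ᵐ[η] S.pull μ φ + S.pull μ ψ := by
  have := (ae_restrict_iff' (S.measurableSet_R μ)).1
    (S.ae_fInv μ (ae_restrict_of_ae (Lp.coeFn_add φ ψ)))
  filter_upwards [this] with x hx
  by_cases hR : x ∈ S.R μ
  · simp only [Pi.add_apply, pull, Set.indicator_of_mem hR, hx hR, mul_add]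
  · simp [pull, hR]

theorem pull_ae_smul (μ : Λ.Edge) (c : ℂ) (φ : Lp ℂ 2 η) :
    S.pull μ ↑(c • φ) =ᵐ[η] c • S.pull μ φ := by
  have := (ae_restrict_iff' (S.measurableSet_R μ)).1
    (S.ae_fInv μ (ae_restrict_of_ae (Lp.coeFn_smul c φ)))
  filter_upwards [this] with x hx
  by_cases hR : x ∈ S.R μ
  · simp [pull, hR, hx hR, mul_left_comm]
  · simp [pull, hR]

/-- The operator on `L²` that represents the vertex `a`. -/
noncomputable def proj (a : V) : Lp ℂ 2 η →L[ℂ] Lp ℂ 2 η := chi η (S.measurableSet_D a)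

theorem proj_coeFn (a : V) (φ : Lp ℂ 2 η) : (S.proj a φ : X → ℂ) =ᵐ[η] (S.D a).indicator φ :=
  chi_coeFn φ

section SigmaFinite

variable [SigmaFinite η]

theorem lintegral_Phi_mul (μ : Λ.Edge) {g : X → ℝ≥0∞}
    (hg : AEMeasurable g (η.restrict (S.R μ))) :
    ∫⁻ x in S.R μ, S.Phi μ x * g x ∂η = ∫⁻ x in S.D μ.src, g (S.f μ x) ∂η := by
  rw [Phi, lintegral_rnDeriv_mul (S.absolutelyContinuous_fInv μ) hg, lintegral_map'
    (hg.mono_ac (S.absolutelyContinuous_fInv μ)) (S.aemeasurable_f μ)]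

/-- The image measure is not given as σ-finite, so finiteness of its density needs an argument. The
sets `{x | f_μ⁻¹ x ∈ A_n}`, with `A_n` exhausting `X` in finite measure, cover `R_μ`, and the
integral of `Φ` over each is at most `η(A_n)`. -/
theorem Phi_lt_top (μ : Λ.Edge) : ∀ᵐ x ∂(η.restrict (S.R μ)), S.Phi μ x < ∞ := by
  have key : ∀ n : ℕ, ∀ᵐ x ∂(η.restrict (S.R μ)),
      S.Phi μ x * (spanningSets η n).indicator 1 (S.fInv μ x) < ∞ := by
    intro n
    have hm : AEMeasurable (fun x => (spanningSets η n).indicator (1 : X → ℝ≥0∞) (S.fInv μ x))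
        (η.restrict (S.R μ)) := S.aemeasurable_comp_fInv μ
      (measurable_one.indicator (measurableSet_spanningSets η n)).aemeasurable
    refine ae_lt_top' ((S.measurable_Phi μ).aemeasurable.mul hm) ?_
    rw [S.lintegral_Phi_mul μ hm]
    have : ∫⁻ x in S.D μ.src, (spanningSets η n).indicator (1 : X → ℝ≥0∞)
        (S.fInv μ (S.f μ x)) ∂η ≤ η (spanningSets η n) := by
      rw [lintegral_congr_ae (g := (spanningSets η n).indicator (1 : X → ℝ≥0∞)),
        lintegral_indicator_one (measurableSet_spanningSets η n)]
      · exact Measure.restrict_apply_le _ _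
      · filter_upwards [S.fInv_f μ] with x hx
        rw [hx]
    exact (this.trans_lt (measure_spanningSets_lt_top η n)).ne
  filter_upwards [ae_all_iff.2 key] with x hx
  obtain ⟨n, hn⟩ := Set.mem_iUnion.1 ((iUnion_spanningSets η).symm ▸ Set.mem_univ (S.fInv μ x))
  simpa [hn] using hx n

/-- The image measure does not charge `{Φ = 0}`, so `f_μ` almost never enters it; pulling back along
`f_μ⁻¹` shows that it is null in `R_μ`. -/
theorem Phi_ne_zero (μ : Λ.Edge) : ∀ᵐ x ∂(η.restrict (S.R μ)), S.Phi μ x ≠ 0 := by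
  have hZ : MeasurableSet {x | S.Phi μ x = 0} := S.measurable_Phi μ (measurableSet_singleton 0)
  have hm : AEMeasurable ({x | S.Phi μ x = 0}.indicator (1 : X → ℝ≥0∞)) (η.restrict (S.R μ)) :=
    (measurable_one.indicator hZ).aemeasurable
  have h1 := S.lintegral_Phi_mul μ hm
  have h2 : ∫⁻ x in S.R μ, S.Phi μ x * {x | S.Phi μ x = 0}.indicator (1 : X → ℝ≥0∞) x ∂η = 0 := by
    rw [← lintegral_zero (μ := η.restrict (S.R μ))]
    congr 1
    funext x
    by_cases hx : S.Phi μ x = 0 <;> simp [hx]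
  rw [h2] at h1
  have h3 := (lintegral_eq_zero_iff' (S.aemeasurable_comp_f μ hm)).1 h1.symm
  filter_upwards [S.ae_fInv μ h3, S.f_fInv μ] with x hx hx' h0
  rw [hx'] at hx
  simp [h0] at hx

theorem enorm_sqrt_mul {p : ℝ≥0∞} (hp : p ≠ ∞) (z : ℂ) :
    ‖(Real.sqrt p.toReal : ℂ) * z‖ₑ ^ 2 = p * ‖z‖ₑ ^ 2 := by
  rw [enorm_mul, mul_pow]
  congr 1
  rw [← ofReal_norm, ← ENNReal.ofReal_pow (norm_nonneg _), Complex.norm_real,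
    Real.norm_eq_abs, sq_abs, Real.sq_sqrt ENNReal.toReal_nonneg, ENNReal.ofReal_toReal hp]

/-- The factor `Φ^{1/2}` squares to the density of the image measure. The weight `g` lets the
identity describe the measure `|S_μ φ|² dη`, not just its total mass. -/
theorem lintegral_pull (μ : Λ.Edge) {φ : X → ℂ} (hφ : AEStronglyMeasurable φ η) {g : X → ℝ≥0∞}
    (hg : AEMeasurable g (η.restrict (S.R μ))) :
    ∫⁻ x, g x * ‖S.pull μ φ x‖ₑ ^ 2 ∂η =
      ∫⁻ x in S.D μ.src, g (S.f μ x) * ‖φ x‖ₑ ^ 2 ∂η := by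
  have h1 : ∀ x, g x * ‖S.pull μ φ x‖ₑ ^ 2 = (S.R μ).indicator (fun x => g x *
      ‖(Real.sqrt (S.Phi μ x).toReal : ℂ) * φ (S.fInv μ x)‖ₑ ^ 2) x := by
    intro x
    by_cases hx : x ∈ S.R μ <;> simp [pull, hx]
  have h2 : AEMeasurable (fun x => ‖φ (S.fInv μ x)‖ₑ ^ 2) (η.restrict (S.R μ)) :=
    (S.aemeasurable_comp_fInv μ hφ.aemeasurable.restrict).enorm.pow_const 2
  simp only [h1]
  rw [lintegral_indicator (S.measurableSet_R μ)]
  rw [lintegral_congr_ae (g := fun x => S.Phi μ x * (g x * ‖φ (S.fInv μ x)‖ₑ ^ 2)),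
    S.lintegral_Phi_mul μ (g := fun x => g x * ‖φ (S.fInv μ x)‖ₑ ^ 2) (hg.mul h2)]
  · refine lintegral_congr_ae ?_
    filter_upwards [S.fInv_f μ] with x hx
    rw [hx]
  · filter_upwards [S.Phi_lt_top μ] with x hx
    rw [enorm_sqrt_mul hx.ne, mul_left_comm]

theorem lintegral_pull_one (μ : Λ.Edge) {φ : X → ℂ} (hφ : AEStronglyMeasurable φ η) :
    ∫⁻ x, ‖S.pull μ φ x‖ₑ ^ 2 ∂η = ∫⁻ x in S.D μ.src, ‖φ x‖ₑ ^ 2 ∂η := by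
  simpa using S.lintegral_pull μ hφ (g := 1) aemeasurable_one

theorem lintegral_pull_le (μ : Λ.Edge) (φ : Lp ℂ 2 η) :
    ∫⁻ x, ‖S.pull μ φ x‖ₑ ^ 2 ∂η ≤ ∫⁻ x, ‖φ x‖ₑ ^ 2 ∂η := by
  rw [S.lintegral_pull_one μ (Lp.aestronglyMeasurable φ)]
  exact setLIntegral_le_lintegral _ _

/-- The operator on `L²` that represents the edge `μ`. -/
noncomputable def op (μ : Λ.Edge) : Lp ℂ 2 η →L[ℂ] Lp ℂ 2 η :=
  lpTwoOperator (S.pull μ)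
    (fun φ => memLp_two_of_lintegral_le (S.pull_aestronglyMeasurable μ (Lp.aestronglyMeasurable φ))
      (Lp.memLp φ) (S.lintegral_pull_le μ φ))
    (S.pull_ae_add μ) (S.pull_ae_smul μ) (S.lintegral_pull_le μ)

theorem op_coeFn (μ : Λ.Edge) (φ : Lp ℂ 2 η) : (S.op μ φ : X → ℂ) =ᵐ[η] S.pull μ φ :=
  lpTwoOperator_coeFn φ

theorem lintegral_op (μ : Λ.Edge) (φ : Lp ℂ 2 η) {g : X → ℝ≥0∞}
    (hg : AEMeasurable g (η.restrict (S.R μ))) :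
    ∫⁻ x, g x * ‖S.op μ φ x‖ₑ ^ 2 ∂η =
      ∫⁻ x in S.D μ.src, g (S.f μ x) * ‖φ x‖ₑ ^ 2 ∂η := by
  rw [← S.lintegral_pull μ (Lp.aestronglyMeasurable φ) hg]
  refine lintegral_congr_ae ?_
  filter_upwards [S.op_coeFn μ φ] with x hx
  rw [hx]

theorem op_eq_zero_of_notMem (μ : Λ.Edge) (φ : Lp ℂ 2 η) :
    ∀ᵐ x ∂η, x ∉ S.R μ → S.op μ φ x = 0 := by
  filter_upwards [S.op_coeFn μ φ] with x hx hR
  rw [hx, pull, Set.indicator_of_notMem hR]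

theorem chi_R_mul_op (μ : Λ.Edge) : chi η (S.measurableSet_R μ) * S.op μ = S.op μ := by
  ext1 φ
  exact (chi_eq_self_iff (hA := S.measurableSet_R μ) (S.op μ φ)).2 (S.op_eq_zero_of_notMem μ φ)

theorem proj_rng_mul_op (μ : Λ.Edge) : S.proj μ.rng * S.op μ = S.op μ := by
  ext1 φ
  refine (chi_eq_self_iff (hA := S.measurableSet_D _) (S.op μ φ)).2 ?_
  filter_upwards [S.op_eq_zero_of_notMem μ φ, S.R_subset μ] with x h1 h2 hx
  exact h1 fun hR => hx (h2 hR)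

theorem op_mul_proj_src (μ : Λ.Edge) : S.op μ * S.proj μ.src = S.op μ := by
  ext1 φ
  apply Lp.ext
  have h := (ae_restrict_iff' (S.measurableSet_R μ)).1
    (S.ae_fInv μ (ae_restrict_of_ae (S.proj_coeFn μ.src φ)))
  filter_upwards [S.op_coeFn μ (S.proj μ.src φ), S.op_coeFn μ φ, h] with x h1 h2 h3
  rw [mul_apply_eq_comp, h1, h2]
  by_cases hR : x ∈ S.R μ
  · simp only [pull, Set.indicator_of_mem hR]
    rw [h3 hR, Set.indicator_of_mem (S.mapsTo_fInv μ hR)]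
  · simp only [pull, Set.indicator_of_notMem hR]

theorem star_op_mul_op (μ : Λ.Edge) : star (S.op μ) * S.op μ = S.proj μ.src := by
  rw [star_mul_self_eq_of_norm (Q := S.proj μ.src), proj, star_chi, chi_idempotent]
  intro φ
  apply Lp_two_norm_eq
  have h1 := S.lintegral_op μ φ (g := 1) aemeasurable_one
  simp only [Pi.one_apply, one_mul] at h1
  rw [h1, ← lintegral_indicator (S.measurableSet_D _)]
  refine lintegral_congr_ae ?_
  filter_upwards [S.proj_coeFn μ.src φ] with x hx
  rw [hx]
  by_cases hD : x ∈ S.D μ.src <;> simp [hD]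

/-- The preimage is `(Φ^{-1/2} ψ) ∘ f_μ` on `D_{s(μ)}`; this is where `Φ` must be finite and
nonzero. -/
theorem exists_op_eq (μ : Λ.Edge) (ψ : Lp ℂ 2 η) :
    ∃ φ, S.op μ φ = chi η (S.measurableSet_R μ) ψ := by
  have hψ : AEMeasurable (fun x => ((Real.sqrt (S.Phi μ x).toReal : ℂ))⁻¹ * ψ x)
      (η.restrict (S.R μ)) := by
    have := S.measurable_Phi μ
    have := (Lp.aestronglyMeasurable ψ).aemeasurable.restrict (s := S.R μ)
    fun_prop
  have hm : MemLp ((S.D μ.src).indicator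
      fun x => ((Real.sqrt (S.Phi μ (S.f μ x)).toReal : ℂ))⁻¹ * ψ (S.f μ x)) 2 η := by
    refine memLp_two_of_lintegral_le ?_ (Lp.memLp ψ) ?_
    · rw [aestronglyMeasurable_indicator_iff (S.measurableSet_D _)]
      exact (S.aemeasurable_comp_f μ hψ).aestronglyMeasurable
    · have h1 : ∀ x, ‖(S.D μ.src).indicator
          (fun x => ((Real.sqrt (S.Phi μ (S.f μ x)).toReal : ℂ))⁻¹ * ψ (S.f μ x)) x‖ₑ ^ 2 =
          (S.D μ.src).indicator (fun x =>
            ‖((Real.sqrt (S.Phi μ (S.f μ x)).toReal : ℂ))⁻¹ * ψ (S.f μ x)‖ₑ ^ 2) x := by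
        intro x
        by_cases hx : x ∈ S.D μ.src <;> simp [hx]
      simp only [h1]
      rw [lintegral_indicator (S.measurableSet_D _),
        ← S.lintegral_Phi_mul μ (hψ.enorm.pow_const 2)]
      refine le_trans (lintegral_mono_ae ?_) (setLIntegral_le_lintegral (S.R μ) _)
      filter_upwards [S.Phi_lt_top μ, S.Phi_ne_zero μ] with x h2 h3
      rw [← enorm_sqrt_mul h2.ne, ← mul_assoc, mul_inv_cancel₀, one_mul]
      have := ENNReal.toReal_pos h3 h2.ne
      exact_mod_cast (Real.sqrt_pos.2 this).ne'
  refine ⟨hm.toLp, Lp.ext ?_⟩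
  have h1 := (ae_restrict_iff' (S.measurableSet_R μ)).1
    (S.ae_fInv μ (ae_restrict_of_ae hm.coeFn_toLp))
  filter_upwards [S.op_coeFn μ hm.toLp, h1, chi_coeFn (hA := S.measurableSet_R μ) ψ,
    (ae_restrict_iff' (S.measurableSet_R μ)).1 (S.Phi_lt_top μ),
    (ae_restrict_iff' (S.measurableSet_R μ)).1 (S.Phi_ne_zero μ),
    (ae_restrict_iff' (S.measurableSet_R μ)).1 (S.f_fInv μ)] with x e1 e2 e3 e4 e5 e6
  rw [e1, e3]
  by_cases hR : x ∈ S.R μ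
  · have := ENNReal.toReal_pos (e5 hR) (e4 hR).ne
    have h0 : (Real.sqrt (S.Phi μ x).toReal : ℂ) ≠ 0 := by
      exact_mod_cast (Real.sqrt_pos.2 this).ne'
    rw [pull, Set.indicator_of_mem hR, Set.indicator_of_mem hR, e2 hR,
      Set.indicator_of_mem (S.mapsTo_fInv μ hR), e6 hR, ← mul_assoc, mul_inv_cancel₀ h0, one_mul]
  · rw [pull, Set.indicator_of_notMem hR, Set.indicator_of_notMem hR]

/-- `S_μ S_μ*` is the identity on the range of `S_μ`, which contains every `χ_{R_μ} ψ`, and `S_μ*`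
ignores what lies off `R_μ`. -/
theorem op_mul_star_op (μ : Λ.Edge) :
    S.op μ * star (S.op μ) = chi η (S.measurableSet_R μ) := by
  have h1 : star (S.op μ) = star (S.op μ) * chi η (S.measurableSet_R μ) := by
    conv_lhs => rw [← S.chi_R_mul_op μ, star_mul, star_chi]
  have h2 : S.op μ * star (S.op μ) * S.op μ = S.op μ := by
    rw [mul_assoc, S.star_op_mul_op, S.op_mul_proj_src]
  rw [h1, ← mul_assoc]
  ext1 ψ
  obtain ⟨φ, hφ⟩ := S.exists_op_eq μ ψ
  rw [mul_apply_eq_comp, ← hφ]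
  exact DFunLike.congr_fun h2 φ

theorem star_op_mul_op_of_null {μ ν : Λ.Edge} (h : η (S.R μ ∩ S.R ν) = 0) :
    star (S.op μ) * S.op ν = 0 := by
  refine star_mul_eq_of_inner fun φ ψ => inner_eq_zero_of_ae ?_
  filter_upwards [S.op_eq_zero_of_notMem μ φ, S.op_eq_zero_of_notMem ν ψ,
    measure_eq_zero_iff_ae_notMem.1 h] with x h1 h2 h3
  by_cases hx : x ∈ S.R μ
  · exact Or.inr (h2 fun hx' => h3 ⟨hx, hx'⟩)
  · exact Or.inl (h1 hx)

theorem op_eq_norm (μ : Λ.Edge) {φ : Lp ℂ 2 η} (hφ : ∀ᵐ x ∂η, φ x = (‖φ x‖ : ℂ)) :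
    ∀ᵐ x ∂η, S.op μ φ x = (‖S.op μ φ x‖ : ℂ) := by
  have h := (ae_restrict_iff' (S.measurableSet_R μ)).1 (S.ae_fInv μ (ae_restrict_of_ae hφ))
  filter_upwards [S.op_coeFn μ φ, h] with x h1 h2
  rw [h1]
  by_cases hR : x ∈ S.R μ
  · rw [pull, Set.indicator_of_mem hR, h2 hR, ← Complex.ofReal_mul, Complex.norm_real,
      Real.norm_of_nonneg (by positivity)]
  · rw [pull, Set.indicator_of_notMem hR]
    simp

theorem lintegral_op_op {μ ν : Λ.Edge} (h : ν.rng = μ.src) (φ : Lp ℂ 2 η) {g : X → ℝ≥0∞}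
    (hg : Measurable g) :
    ∫⁻ x, g x * ‖S.op μ (S.op ν φ) x‖ₑ ^ 2 ∂η =
      ∫⁻ x in S.D ν.src, g (S.f μ (S.f ν x)) * ‖φ x‖ₑ ^ 2 ∂η := by
  -- Nothing is known of `f_μ` off `D_{s(μ)}`, so the weight is cut off there; the cutoff is
  -- harmless since `f_ν` lands in `R_ν`, almost all of which lies in `D_{s(μ)}`.
  have hm : AEMeasurable ((S.D μ.src).indicator fun x => g (S.f μ x)) (η.restrict (S.R ν)) :=
    ((aemeasurable_indicator_iff (S.measurableSet_D _)).2
      (S.aemeasurable_comp_f μ hg.aemeasurable)).restrict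
  rw [S.lintegral_op μ _ hg.aemeasurable, ← lintegral_indicator (S.measurableSet_D _)]
  have e : ∀ x, (S.D μ.src).indicator (fun x => g (S.f μ x) * ‖S.op ν φ x‖ₑ ^ 2) x =
      (S.D μ.src).indicator (fun x => g (S.f μ x)) x * ‖S.op ν φ x‖ₑ ^ 2 := by
    intro x
    by_cases hx : x ∈ S.D μ.src <;> simp [hx]
  simp only [e]
  rw [S.lintegral_op ν φ hm]
  refine lintegral_congr_ae ?_
  have h2 : ∀ᵐ x ∂(η.restrict (S.R ν)), x ∈ S.D μ.src := by
    rw [ae_restrict_iff' (S.measurableSet_R ν), ← h]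
    exact S.R_subset ν
  filter_upwards [S.ae_f ν h2] with x hx
  rw [Set.indicator_of_mem hx]

/-- No chain rule for the densities is needed: for nonnegative `φ` both sides are nonnegative, and
their squares are densities of the image of `|φ|² dη` under `f_μ ∘ f_ν = f_α ∘ f_β`. -/
theorem op_mul_op {μ ν α β : Λ.Edge} {lam : Arrow V} (H : IsComp μ.path ν.path lam)
    (H' : IsComp α.path β.path lam) : S.op μ * S.op ν = S.op α * S.op β := by
  refine lpTwo_ext_of_nonneg fun φ hφ => ?_
  have hsrc : ν.src = β.src := H.left_eq.symm.trans H'.left_eq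
  have h1 : (fun x => ‖S.op μ (S.op ν φ) x‖ₑ ^ 2) =ᵐ[η] fun x => ‖S.op α (S.op β φ) x‖ₑ ^ 2 := by
    refine ae_eq_of_forall_setLIntegral_eq_of_sigmaFinite₀
      ((Lp.aestronglyMeasurable _).aemeasurable.enorm.pow_const 2)
      ((Lp.aestronglyMeasurable _).aemeasurable.enorm.pow_const 2) fun A hA _ => ?_
    have hg : Measurable (A.indicator (1 : X → ℝ≥0∞)) := measurable_one.indicator hA
    have e : ∀ ψ : Lp ℂ 2 η, ∫⁻ x in A, ‖ψ x‖ₑ ^ 2 ∂η =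
        ∫⁻ x, A.indicator (1 : X → ℝ≥0∞) x * ‖ψ x‖ₑ ^ 2 ∂η := by
      intro ψ
      rw [← lintegral_indicator hA]
      congr 1
      funext x
      by_cases hx : x ∈ A <;> simp [hx]
    rw [e, e, S.lintegral_op_op H.source_eq φ hg, S.lintegral_op_op H'.source_eq φ hg, ← hsrc]
    refine lintegral_congr_ae ?_
    filter_upwards [S.comp_eq μ ν α β lam H H'] with x hx
    rw [hx]
  apply Lp.ext
  filter_upwards [h1, S.op_eq_norm μ (S.op_eq_norm ν hφ), S.op_eq_norm α (S.op_eq_norm β hφ)]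
    with x e1 e2 e3
  rw [mul_apply_eq_comp, mul_apply_eq_comp, e2, e3]
  have e4 : ‖S.op μ (S.op ν φ) x‖ₑ = ‖S.op α (S.op β φ) x‖ₑ :=
    (ENNReal.pow_right_strictMono two_ne_zero).injective e1
  rw [enorm_eq_iff_norm_eq.1 e4]

theorem ae_eq_zero_of_star_op {μ : Λ.Edge} {φ : Lp ℂ 2 η} (h : star (S.op μ) φ = 0) :
    ∀ᵐ x ∂η, x ∈ S.R μ → φ x = 0 := by
  rw [← chi_eq_zero_iff (hA := S.measurableSet_R μ), ← S.op_mul_star_op μ,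
    mul_apply_eq_comp, h, map_zero]

/-- If `S_α* φ = 0` then `φ` vanishes on `R_α`, and `S_μ` moves supports by `f_μ`. Countability
allows one null set for all `α`. -/
theorem op_ae_mem_image [Countable Λ.Edge] (μ : Λ.Edge) (C : Set Λ.Edge) {φ : Lp ℂ 2 η}
    (h : ∀ α ∈ C, star (S.op α) φ = 0) :
    ∀ᵐ x ∂η, S.op μ φ x ≠ 0 → x ∈ S.f μ '' (S.D μ.src \ ⋃ (α : Λ.Edge) (_ : α ∈ C), S.R α) := by
  have h1 : ∀ᵐ x ∂η, ∀ α ∈ C, x ∈ S.R α → φ x = 0 := by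
    rw [ae_all_iff]
    intro α
    by_cases hα : α ∈ C
    · filter_upwards [S.ae_eq_zero_of_star_op (h α hα)] with x hx _ using hx
    · exact Filter.Eventually.of_forall fun x hx => absurd hx hα
  filter_upwards [S.op_coeFn μ φ,
    (ae_restrict_iff' (S.measurableSet_R μ)).1 (S.ae_fInv μ (ae_restrict_of_ae h1)),
    (ae_restrict_iff' (S.measurableSet_R μ)).1 (S.f_fInv μ)] with x e1 e2 e3 hne
  by_cases hR : x ∈ S.R μ
  · refine ⟨S.fInv μ x, ⟨S.mapsTo_fInv μ hR, ?_⟩, e3 hR⟩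
    intro hmem
    simp only [Set.mem_iUnion] at hmem
    obtain ⟨α, hα, hx⟩ := hmem
    apply hne
    rw [e1, pull, Set.indicator_of_mem hR, e2 hR α hα hx, mul_zero]
  · rw [e1, pull, Set.indicator_of_notMem hR] at hne
    exact absurd rfl hne

/-- The operators on `L²` that represent the paths. -/
noncomputable def pathOp (lam : Arrow V) : Lp ℂ 2 η →L[ℂ] Lp ℂ 2 η := extend Λ S.op S.proj lam

theorem pathOp_edge (μ : Λ.Edge) : S.pathOp μ.path = S.op μ :=
  extend_edge (fun _ _ _ _ _ => S.op_mul_op) S.op_mul_proj_src μ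

theorem pathOp_vertexPath (a : V) : S.pathOp (vertexPath a) = S.proj a := extend_vertexPath a

theorem edgeRelations_pathOp [Countable (Arrow V)] : Λ.EdgeRelations S.pathOp where
  vertex_selfAdjoint a := by rw [pathOp_vertexPath, proj, star_chi]
  vertex_idempotent a := by rw [pathOp_vertexPath, proj, chi_idempotent]
  vertex_orthogonal a b hab := by
    rw [pathOp_vertexPath, pathOp_vertexPath, proj, proj, chi_mul_eq_zero (S.D_disjoint a b hab)]
  comp μ ν lam H := extend_comp (fun _ _ _ _ _ => S.op_mul_op) S.proj_rng_mul_op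
    (fun a => chi_idempotent) _ rfl H
  star_mul_self μ := by rw [pathOp_edge, pathOp_vertexPath, star_op_mul_op]
  star_mul_of_deg_eq μ ν hne hd := by
    rw [pathOp_edge, pathOp_edge, S.star_op_mul_op_of_null (S.R_disjoint μ ν hne hd)]
  star_mul_of_deg_ne μ ν hr hd x y hx hy := by
    have : Countable Λ.Edge := inferInstanceAs (Countable (Subtype _))
    simp only [pathOp_edge] at hx hy ⊢
    refine star_mul_eq_of_inner fun φ ψ => inner_eq_zero_of_ae ?_
    -- The two vectors are supported in the two images whose intersection is null, hence are
    -- orthogonal.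
    filter_upwards [measure_eq_zero_iff_ae_notMem.1 (S.min_disjoint μ ν hr hd),
      S.op_ae_mem_image μ {α | ∃ β : Arrow V, (α.path, β) ∈ Λ.minExt μ.path ν.path} (φ := x φ)
        fun α hα => DFunLike.congr_fun (hx α hα) φ,
      S.op_ae_mem_image ν {β | ∃ α : Arrow V, (α, β.path) ∈ Λ.minExt μ.path ν.path} (φ := y ψ)
        fun β hβ => DFunLike.congr_fun (hy β hβ) ψ] with z h1 h2 h3
    by_contra hc
    push Not at hc
    exact h1 ⟨h2 hc.1, h3 hc.2⟩
  exhaustive a E hE x hx := by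
    simp only [pathOp_edge, pathOp_vertexPath] at hx ⊢
    ext1 φ
    refine (chi_eq_zero_iff (hA := S.measurableSet_D a) (x φ)).2 ?_
    have h1 : ∀ᵐ z ∂η, ∀ μ ∈ E, z ∈ S.R μ → x φ z = 0 := by
      rw [Finset.eventually_all]
      intro μ hμ
      exact S.ae_eq_zero_of_star_op (DFunLike.congr_fun (hx μ hμ) φ)
    filter_upwards [h1, S.exhaustive a E hE] with z h2 h3 hz
    have h4 : z ∈ ⋃ μ ∈ E, S.R μ := cast h3.symm hz
    simp only [Set.mem_iUnion] at h4
    obtain ⟨μ, hμ, hzμ⟩ := h4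
    exact h2 μ hμ hzμ

end SigmaFinite

end KGraph.BranchingSystem

/-! ### Representations of `C*(Λ)` and uniqueness -/

namespace KGraph

variable {k : ℕ} {V : Type u} [Category.{v} V] {Λ : KGraph k V}

/-- The representation of `C*(Λ)` given by a Cuntz-Krieger `Λ`-family. -/
noncomputable def repOfFamily (i : CKRep.{w} Λ) : CStar.{w} Λ →⋆ₙₐ[ℂ] i.B where
  toFun x := x.1 i
  map_smul' _ _ := rfl
  map_zero' := rfl
  map_add' _ _ := rfl
  map_mul' _ _ := rfl
  map_star' _ := rfl

theorem gen_comp {μ ν lam : Arrow V} (H : IsComp μ ν lam) :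
    gen.{w} Λ lam = gen.{w} Λ μ * gen.{w} Λ ν :=
  Subtype.ext (lp.ext (funext fun i => i.isCK.comp μ ν lam H))

-- Homomorphisms of C*-algebras are automatically continuous, and the *-algebra generated by the
-- universal family is dense.
open scoped CStarAlgebra in
theorem hom_ext {A : Type*} [NonUnitalCStarAlgebra A] {π ρ : CStar.{w} Λ →⋆ₙₐ[ℂ] A}
    (h : ∀ μ, π (gen.{w} Λ μ) = ρ (gen.{w} Λ μ)) : π = ρ := by
  have hπ : Continuous π := map_continuous π
  have hρ : Continuous ρ := map_continuous ρ
  let T := (NonUnitalStarAlgebra.adjoin ℂ (Set.range (universalFamily.{w} Λ)))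
  have hT : ∀ x (hx : x ∈ T), π ⟨x, NonUnitalStarSubalgebra.le_topologicalClosure _ hx⟩ =
      ρ ⟨x, NonUnitalStarSubalgebra.le_topologicalClosure _ hx⟩ := by
    intro x hx
    induction hx using NonUnitalStarAlgebra.adjoin_induction with
    | mem x hx =>
      obtain ⟨μ, rfl⟩ := hx
      exact h μ
    | add x y hx hy h1 h2 =>
      have := congrArg₂ (· + ·) h1 h2
      simp only [← map_add] at this
      exact this
    | zero => exact (map_zero π).trans (map_zero ρ).symm
    | mul x y hx hy h1 h2 =>
      have := congrArg₂ (· * ·) h1 h2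
      simp only [← map_mul] at this
      exact this
    | smul c x hx h1 =>
      have := congrArg (c • ·) h1
      simp only [← map_smul] at this
      exact this
    | star x hx h1 =>
      have := congrArg star h1
      simp only [← map_star] at this
      exact this
  have hd : Dense {x : CStar.{w} Λ | (x : BigProduct.{w} Λ) ∈ T} := by
    intro x
    rw [closure_subtype]
    have h1 : ((↑) '' {x : CStar.{w} Λ | (x : BigProduct.{w} Λ) ∈ T} : Set (BigProduct.{w} Λ)) =
        T := by
      ext y
      refine ⟨?_, fun hy => ⟨⟨y, NonUnitalStarSubalgebra.le_topologicalClosure _ hy⟩, hy, rfl⟩⟩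
      rintro ⟨z, hz, rfl⟩
      exact hz
    rw [h1]
    exact x.2
  exact DFunLike.coe_injective (hπ.ext_on hd hρ fun x hx => hT x.1 hx)

theorem hom_ext_of_edges {A : Type*} [NonUnitalCStarAlgebra A] {π ρ : CStar.{w} Λ →⋆ₙₐ[ℂ] A}
    (he : ∀ μ : Λ.Edge, π (gen.{w} Λ μ.path) = ρ (gen.{w} Λ μ.path))
    (hv : ∀ a, π (gen.{w} Λ (vertexPath a)) = ρ (gen.{w} Λ (vertexPath a))) : π = ρ := by
  refine hom_ext fun μ => ?_
  induction hn : Λ.length μ generalizing μ with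
  | zero =>
    rw [Λ.eq_vertexPath (Λ.deg_eq_zero_of_length hn)]
    exact hv _
  | succ m ih =>
    have h0 : Λ.deg μ ≠ 0 := by
      intro h0
      simp [length, h0] at hn
    obtain ⟨g, μ', hg⟩ := Λ.exists_first_edge h0
    have hl := Λ.length_eq_of_isComp hg
    rw [length_edge] at hl
    rw [gen_comp hg, map_mul, map_mul, he, ih μ' (by omega)]

end KGraph

theorem mainTheorem4 {k : ℕ} (hk : 0 < k) {V : Type u} [Category.{v} V] [Countable (Arrow V)]
    (Λ : KGraph k V) (hΛ : Λ.FinitelyAligned)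
    {X : Type w} [MeasurableSpace X] (η : Measure X) [SigmaFinite η]
    (S : Λ.BranchingSystem η) :
    ∃! π : KGraph.CStar.{w} Λ →⋆ₙₐ[ℂ] (Lp ℂ 2 η →L[ℂ] Lp ℂ 2 η),
      (∀ (μ : Λ.Edge) (φ : Lp ℂ 2 η),
        (π (KGraph.gen.{w} Λ μ.path) φ : X → ℂ) =ᵐ[η]
          (S.R μ).indicator
            (fun x => (Real.sqrt (S.Phi μ x).toReal : ℂ) * φ (S.fInv μ x))) ∧
      (∀ (a : V) (φ : Lp ℂ 2 η),
        (π (KGraph.gen.{w} Λ (vertexPath a)) φ : X → ℂ) =ᵐ[η]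
          (S.D a).indicator (fun x => φ x)) := by
  -- Since `X` lies in the universe `w`, this family is one of the coordinates of the product that
  -- contains `C*(Λ)`; the representation is evaluation at it.
  let i : KGraph.CKRep.{w} Λ :=
    ⟨Lp ℂ 2 η →L[ℂ] Lp ℂ 2 η, S.pathOp, S.edgeRelations_pathOp.isCKFamily hΛ⟩
  have hedge : ∀ (μ : Λ.Edge) (φ : Lp ℂ 2 η), (S.pathOp μ.path φ : X → ℂ) =ᵐ[η] S.pull μ φ := by
    intro μ φ
    rw [S.pathOp_edge]
    exact S.op_coeFn μ φ
  have hvertex : ∀ (a : V) (φ : Lp ℂ 2 η),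
      (S.pathOp (vertexPath a) φ : X → ℂ) =ᵐ[η] (S.D a).indicator φ := by
    intro a φ
    rw [S.pathOp_vertexPath]
    exact S.proj_coeFn a φ
  refine ⟨KGraph.repOfFamily i, ⟨hedge, hvertex⟩, ?_⟩
  rintro ρ ⟨h1, h2⟩
  refine KGraph.hom_ext_of_edges (fun μ => ?_) fun a => ?_
  · ext1 φ
    exact Lp.ext ((h1 μ φ).trans (hedge μ φ).symm)
  · ext1 φ
    exact Lp.ext ((h2 a φ).trans (hvertex a φ).symm)
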